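/- On a complex manifold $X$ of complex dimension $n$, identify a Hermitian metric with its fundamental form $F$, a smooth real positive $(1,1)$-form. The metric is Kähler if $dF=0$, balanced if $d(F^{n-1})=0$, astheno-Kähler if $\partial\bar\partial(F^{n-2})=0$, and $k$-th Gauduchon (for $1\le k\le n-1$) if $\partial\bar\partial(F^k)\wedge F^{n-k-1}=0$. Theorem. For every integer $n\ge 4$ there is a compact (connected) complex manifold $X$ of complex dimension $n$ that admits no Kähler metric, that admits a balanced Hermitian metric $\tilde F$, and that admits an astheno-Kähler Hermitian metric $F$ which is moreover $k$-th Gauduchon for every $1\le k\le n-1$. Moreover, $X$ can be taken to be a complex nilmanifold $\Gamma\backslash G$, where $G$ is a simply connected nilpotent real Lie group with a left-invariant complex structure, $G$ is isomorphic to $H_{2n-1}\times\mathbb R$ with $H_{2n-1}$ the real Heisenberg group of dimension $2n-1$ (so that its Lie algebra is $\mathfrak h_{2n-1}\times\mathbb R$), and $\Gamma$ is a discrete cocompact subgroup. There are a frame $\omega^1,\dots,\omega^n$ of smooth $(1,0)$-forms on $X$ induced by left-invariant forms on $G$ and nonzero real numbers $a_1,\dots,a_{n-1}$ with $\sum_{j=1}^{n-1}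 a_j=0$ such that $$d\omega^1=\cdots=d\omega^{n-1}=0,\qquad d\omega^n=\sum_{j=1}^{n-1}a_j\,\omega^j\wedge\overline{\omega^j}.$$ -/

import Mathlib

open scoped Manifold ContDiff

noncomputable section

namespace CplxGeom

/-! Pointwise linear algebra: complex-valued real-multilinear alternating forms on a complex
vector space `E` (elements of the exterior powers of the complexified dual). -/

section Linear

variable {E : Type*} [NormedAddCommGroup E] [NormedSpace ℂ E]

/-- The multilinear map `v ↦ a (v₁, …, v_p) * b (v_{p+1}, …, v_{p+q})`. -/
def tensorMul {p q : ℕ} (a : E [⋀^Fin p]→L[ℝ] ℂ) (b : E [⋀^Fin q]→L[ℝ] ℂ) :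
    ContinuousMultilinearMap ℝ (fun _ : Fin (p + q) => E) ℂ where
  toFun v := a (fun i => v (Fin.castAdd q i)) * b (fun i => v (Fin.natAdd p i))
  map_update_add' := by
    intro inst v i x y
    have hinst : inst = instDecidableEqFin (p + q) := Subsingleton.elim _ _
    subst hinst
    induction i using Fin.addCases with
    | left i =>
      have h1 : ∀ z : E, (fun j => Function.update v (Fin.castAdd q i) z (Fin.castAdd q j)) =
          Function.update (fun j => v (Fin.castAdd q j)) i z := by
        intro z; funext j; by_cases h : j = i
        · subst h; simp
        · simp [Function.update_of_ne, h]
      have h2 : ∀ z : E, (fun j => Function.update v (Fin.castAdd q i) z (Fin.natAdd p j)) =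
          fun j => v (Fin.natAdd p j) := by
        intro z; funext j
        refine Function.update_of_ne ?_ _ _
        intro h; have := congrArg Fin.val h; simp at this; omega
      simp only [h1, h2, ContinuousAlternatingMap.map_update_add, add_mul]
    | right i =>
      have h1 : ∀ z : E, (fun j => Function.update v (Fin.natAdd p i) z (Fin.natAdd p j)) =
          Function.update (fun j => v (Fin.natAdd p j)) i z := by
        intro z; funext j; by_cases h : j = i
        · subst h; simp
        · simp [Function.update_of_ne, h]
      have h2 : ∀ z : E, (fun j => Function.update v (Fin.natAdd p i) z (Fin.castAdd q j)) =
          fun j => v (Fin.castAdd q j) := by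
        intro z; funext j
        refine Function.update_of_ne ?_ _ _
        intro h; have := congrArg Fin.val h; simp at this; omega
      simp only [h1, h2, ContinuousAlternatingMap.map_update_add, mul_add]
  map_update_smul' := by
    intro inst v i c x
    have hinst : inst = instDecidableEqFin (p + q) := Subsingleton.elim _ _
    subst hinst
    induction i using Fin.addCases with
    | left i =>
      have h1 : ∀ z : E, (fun j => Function.update v (Fin.castAdd q i) z (Fin.castAdd q j)) =
          Function.update (fun j => v (Fin.castAdd q j)) i z := by
        intro z; funext j; by_cases h : j = i
        · subst h; simp
        · simp [Function.update_of_ne, h]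
      have h2 : ∀ z : E, (fun j => Function.update v (Fin.castAdd q i) z (Fin.natAdd p j)) =
          fun j => v (Fin.natAdd p j) := by
        intro z; funext j
        refine Function.update_of_ne ?_ _ _
        intro h; have := congrArg Fin.val h; simp at this; omega
      simp only [h1, h2, ContinuousAlternatingMap.map_update_smul, smul_mul_assoc]
    | right i =>
      have h1 : ∀ z : E, (fun j => Function.update v (Fin.natAdd p i) z (Fin.natAdd p j)) =
          Function.update (fun j => v (Fin.natAdd p j)) i z := by
        intro z; funext j; by_cases h : j = i
        · subst h; simp
        · simp [Function.update_of_ne, h]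
      have h2 : ∀ z : E, (fun j => Function.update v (Fin.natAdd p i) z (Fin.castAdd q j)) =
          fun j => v (Fin.castAdd q j) := by
        intro z; funext j
        refine Function.update_of_ne ?_ _ _
        intro h; have := congrArg Fin.val h; simp at this; omega
      simp only [h1, h2, ContinuousAlternatingMap.map_update_smul, mul_smul_comm]
  cont := by fun_prop

/-- The wedge product of alternating forms,
`(a ∧ b)(v) = 1/(p! q!) ∑_σ sgn σ · a (v_{σ1}, …, v_{σp}) b (v_{σ(p+1)}, …, v_{σ(p+q)})`;
for 1-forms this is `a(v₁) b(v₂) - a(v₂) b(v₁)`. -/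
def wedge {p q : ℕ} (a : E [⋀^Fin p]→L[ℝ] ℂ) (b : E [⋀^Fin q]→L[ℝ] ℂ) :
    E [⋀^Fin (p + q)]→L[ℝ] ℂ :=
  (1 / ((p.factorial : ℝ) * (q.factorial : ℝ))) •
    ContinuousMultilinearMap.alternatization (tensorMul a b)

/-- The power `F ∧ ⋯ ∧ F` (`k` factors) of a 2-form, with `F ^ 0 = 1`. -/
def wedgePow (F : E [⋀^Fin 2]→L[ℝ] ℂ) : (k : ℕ) → E [⋀^Fin (2 * k)]→L[ℝ] ℂ
  | 0 => ContinuousAlternatingMap.constOfIsEmpty ℝ E (Fin 0) 1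
  | k + 1 => wedge (wedgePow F k) F

/-- The alternating form `v ↦ α (c v₁, …, c v_r)`. -/
def rotate {r : ℕ} (c : ℂ) (α : E [⋀^Fin r]→L[ℝ] ℂ) : E [⋀^Fin r]→L[ℝ] ℂ :=
  α.compContinuousLinearMap ((c • ContinuousLinearMap.id ℂ E).restrictScalars ℝ)

/-- A form of degree `r = p + q` is of type `(p, q)` iff multiplying all its arguments by a complex
number `c` multiplies it by `c ^ p * conj c ^ q`. -/
def HasType {r : ℕ} (p q : ℕ) (α : E [⋀^Fin r]→L[ℝ] ℂ) : Prop :=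
  p + q = r ∧ ∀ c : ℂ, rotate c α = (c ^ p * (starRingEnd ℂ c) ^ q) • α

/-- The `m`-th of the `r + 1` sample points `exp (π i m / (r + 1))` on the upper unit half-circle. -/
def samplePt (r m : ℕ) : ℂ := Complex.exp (((Real.pi * m / (r + 1) : ℝ) : ℂ) * Complex.I)

/-- The component of type `(p, r - p)` of a form of degree `r`, for `p ≤ r`. A unit complex number
`c` acts on the forms of type `(p, q)` by `c ^ p * conj c ^ q`, and the components are recovered as
discrete Fourier coefficients of this action: the map is the identity on the forms of type
`(p, r - p)` and kills the forms of every other type (see the two lemmas below). -/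
def typePart {r : ℕ} (p : ℕ) (α : E [⋀^Fin r]→L[ℝ] ℂ) : E [⋀^Fin r]→L[ℝ] ℂ :=
  (1 / ((r : ℂ) + 1)) • ∑ m ∈ Finset.range (r + 1),
    ((starRingEnd ℂ (samplePt r m)) ^ p * (samplePt r m) ^ (r - p)) • rotate (samplePt r m) α

theorem samplePt_zpow_sum {r : ℕ} {k : ℤ} (hk : k ≠ 0) (h1 : -(r : ℤ) ≤ k) (h2 : k ≤ r) :
    ∑ m ∈ Finset.range (r + 1), (samplePt r m) ^ (2 * k) = 0 := by
  have hz := Complex.isPrimitiveRoot_exp (r + 1) (Nat.succ_ne_zero r)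
  set ζ : ℂ := Complex.exp (2 * Real.pi * Complex.I / ((r + 1 : ℕ) : ℂ)) with hζ
  have hpt : ∀ m : ℕ, (samplePt r m) ^ (2 * k) = (ζ ^ k) ^ m := by
    intro m
    rw [samplePt, hζ, ← Complex.exp_int_mul, ← Complex.exp_int_mul, ← Complex.exp_nat_mul]
    congr 1
    push_cast
    ring
  simp only [hpt]
  have hne : ζ ^ k ≠ 1 := by
    intro h
    rw [hz.zpow_eq_one_iff_dvd] at h
    obtain ⟨c, hc⟩ := h
    push_cast at hc
    rcases lt_trichotomy c 0 with h | h | h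
    · nlinarith
    · subst h; simp at hc; exact hk hc
    · nlinarith
  rw [geom_sum_eq hne, ← zpow_natCast, ← zpow_mul, mul_comm k, zpow_mul, zpow_natCast,
    hz.pow_eq_one]
  simp

theorem samplePt_coeff {r p q s : ℕ} (hpq : p + q = r) (hs : s ≤ r) (m : ℕ) :
    ((starRingEnd ℂ (samplePt r m)) ^ s * (samplePt r m) ^ (r - s)) *
      ((samplePt r m) ^ p * (starRingEnd ℂ (samplePt r m)) ^ q) =
      (samplePt r m) ^ (2 * ((p : ℤ) - s)) := by
  have hn : samplePt r m ≠ 0 := Complex.exp_ne_zero _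
  have hconj : starRingEnd ℂ (samplePt r m) = (samplePt r m)⁻¹ := by
    rw [samplePt, ← Complex.exp_conj, ← Complex.exp_neg]
    congr 1
    simp [Complex.conj_ofReal]
  rw [hconj]
  obtain ⟨t, rfl⟩ := Nat.exists_eq_add_of_le hs
  have ht : s + t - s = t := by omega
  rw [ht]
  simp only [← zpow_natCast, inv_zpow', ← zpow_add₀ hn]
  congr 1
  omega

/-- The projection to the type `(p, q)` is the identity on forms of type `(p, q)`. -/
theorem typePart_of_hasType {r p q : ℕ} {α : E [⋀^Fin r]→L[ℝ] ℂ} (h : HasType p q α) :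
    typePart p α = α := by
  obtain ⟨hpq, h⟩ := h
  have hr : ((r : ℂ) + 1) ≠ 0 := by exact_mod_cast Nat.succ_ne_zero r
  unfold typePart
  simp only [h, smul_smul, samplePt_coeff hpq (show p ≤ r by omega)]
  rw [← Finset.sum_smul, smul_smul]
  simp [hr]

/-- The projection to the type `(s, r - s)` kills the forms of any other type. -/
theorem typePart_of_hasType_ne {r p q s : ℕ} {α : E [⋀^Fin r]→L[ℝ] ℂ} (h : HasType p q α)
    (hs : s ≤ r) (hne : s ≠ p) : typePart s α = 0 := by
  obtain ⟨hpq, h⟩ := h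
  unfold typePart
  simp only [h, smul_smul, samplePt_coeff hpq hs]
  rw [← Finset.sum_smul, samplePt_zpow_sum (by omega) (by omega) (by omega)]
  simp

end Linear

/-! Differential forms on complex manifolds. A complex manifold is a space `X` charted on a
finite-dimensional complex vector space `E` with holomorphic (i.e. complex-analytic) transition
maps: `IsManifold 𝓘(ℂ, E) ω X`. Mathlib's tangent space at `x` is `E` itself, the tangent vectors
being read in the preferred chart `chartAt E x`, and the complex structure `J` of `X` is
multiplication by `I` on each tangent space. -/

section Forms

variable {E : Type*} [NormedAddCommGroup E] [NormedSpace ℂ E]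

/-- A (not necessarily smooth) complex-valued differential form of degree `r` on the underlying
real manifold of `X`: an element of `Λ^r T_x^* X ⊗ ℂ` for every point `x`. -/
abbrev DiffForm (E : Type*) [NormedAddCommGroup E] [NormedSpace ℂ E] (X : Type*) (r : ℕ) :=
  X → E [⋀^Fin r]→L[ℝ] ℂ

variable {X : Type*} [TopologicalSpace X] [ChartedSpace E X]
variable {Y : Type*} [TopologicalSpace Y] [ChartedSpace E Y]

/-- The pullback `f^* α` along a holomorphic map `f : Y → X`. -/
def pullback {r : ℕ} (f : Y → X) (α : DiffForm E X r) : DiffForm E Y r := fun y =>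
  (α (f y)).compContinuousLinearMap
    ((mfderiv 𝓘(ℂ, E) 𝓘(ℂ, E) f y : E →L[ℂ] E).restrictScalars ℝ)

/-- The expression of a form in the preferred chart at `x`, a form on an open subset of `E`
(the target of the chart). -/
def inChart {r : ℕ} (x : X) (α : DiffForm E X r) : DiffForm E E r :=
  pullback (chartAt E x).symm α

/-- A form is smooth if its expressions in charts are. -/
def IsSmoothForm {r : ℕ} (α : DiffForm E X r) : Prop :=
  ∀ x : X, ContDiffOn ℝ ∞ (inChart x α) (chartAt E x).target

/-- The exterior derivative, computed at each point `x` in the preferred chart at `x`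
(whose differential at `x` is the identity). -/
def extd {r : ℕ} (α : DiffForm E X r) : DiffForm E X (r + 1) := fun x =>
  extDeriv (𝕜 := ℝ) (inChart x α) (chartAt E x x)

/-- The operator `∂`: on a form of type `(p, q)` it is the `(p + 1, q)`-part of `d`. -/
def del {r : ℕ} (α : DiffForm E X r) : DiffForm E X (r + 1) := fun x =>
  ∑ p ∈ Finset.range (r + 1), typePart (p + 1) (extd (fun y => typePart p (α y)) x)

/-- The operator `∂̄`: on a form of type `(p, q)` it is the `(p, q + 1)`-part of `d`. -/
def delbar {r : ℕ} (α : DiffForm E X r) : DiffForm E X (r + 1) := fun x =>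
  ∑ p ∈ Finset.range (r + 1), typePart p (extd (fun y => typePart p (α y)) x)

/-- The pointwise power of a 2-form. -/
def formPow (F : DiffForm E X 2) (k : ℕ) : DiffForm E X (2 * k) := fun x => wedgePow (F x) k

/-- The complex conjugate of a form. -/
def conjForm {r : ℕ} (α : DiffForm E X r) : DiffForm E X r := fun x =>
  (Complex.conjCLE : ℂ →L[ℝ] ℂ).compContinuousAlternatingMap (α x)

/-- `F` is (the fundamental form of) a Hermitian metric: a smooth real form of type `(1, 1)` which
is positive, i.e. `F (v, J v) > 0` for every nonzero tangent vector `v`. With this convention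
`(i / 2) ∑ dz_j ∧ dz̄_j` is the standard metric of `ℂⁿ`. -/
structure IsHermitianMetric (F : DiffForm E X 2) : Prop where
  smooth : IsSmoothForm F
  real : conjForm F = F
  type : ∀ x, HasType 1 1 (F x)
  pos : ∀ (x : X) (v : E), v ≠ 0 → 0 < (F x ![v, Complex.I • v]).re

variable (E X) in
/-- `X` is Kähler: it has a Hermitian metric with closed fundamental form. -/
def IsKahlerManifold : Prop :=
  ∃ F : DiffForm E X 2, IsHermitianMetric F ∧ extd F = 0

/-- In complex dimension `n`, the Hermitian metric `F` is balanced: `d F^(n-1) = 0`. -/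
def IsBalanced (n : ℕ) (F : DiffForm E X 2) : Prop :=
  IsHermitianMetric F ∧ extd (formPow F (n - 1)) = 0

/-- In complex dimension `n`, the Hermitian metric `F` is astheno-Kähler: `∂∂̄ F^(n-2) = 0`. -/
def IsAsthenoKahler (n : ℕ) (F : DiffForm E X 2) : Prop :=
  IsHermitianMetric F ∧ del (delbar (formPow F (n - 2))) = 0

/-- In complex dimension `n`, the Hermitian metric `F` is `k`-th Gauduchon:
`∂∂̄ F^k ∧ F^(n-k-1) = 0`. -/
def IsGauduchon (n k : ℕ) (F : DiffForm E X 2) : Prop :=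
  IsHermitianMetric F ∧
    ∀ x : X, wedge (del (delbar (formPow F k)) x) (formPow F (n - k - 1) x) = 0

variable (E X) in
/-- `X` is a compact (connected) complex manifold. -/
structure IsCompactComplexManifold : Prop where
  isManifold : IsManifold 𝓘(ℂ, E) ω X
  compact : CompactSpace X
  connected : ConnectedSpace X
  hausdorff : T2Space X
  secondCountable : SecondCountableTopology X

end Forms

/-! Complex nilmanifolds. -/

section Nilmanifolds

variable {E : Type*} [NormedAddCommGroup E] [NormedSpace ℂ E]

/-- `X`, with the projection `π : G → X`, is a complex nilmanifold `Γ \ G`: `G` is a simply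
connected nilpotent real Lie group with a left-invariant complex structure (given by the atlas of
`G`, whose underlying real smooth structure is that of the Lie group), `Γ` is a discrete
subgroup, and `π` identifies `X`, which is compact, with the space of cosets `Γ g` as a complex
manifold. -/
structure IsComplexNilmanifold (E : Type*) [NormedAddCommGroup E] [NormedSpace ℂ E]
    {X : Type*} [TopologicalSpace X] [ChartedSpace E X]
    {G : Type*} [Group G] [TopologicalSpace G] [ChartedSpace E G]
    (Γ : Subgroup G) (π : G → X) : Prop where
  lieGroup : LieGroup 𝓘(ℝ, E) ∞ G
  simplyConnected : SimplyConnectedSpace G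
  nilpotent : Group.IsNilpotent G
  complexManifold : IsManifold 𝓘(ℂ, E) ω G
  leftInvariant : ∀ g : G, ContMDiff 𝓘(ℂ, E) 𝓘(ℂ, E) ω (fun h : G => g * h)
  discrete : DiscreteTopology Γ
  isCompactComplexManifold : IsCompactComplexManifold E X
  surjective : Function.Surjective π
  fibers : ∀ g h : G, π g = π h ↔ ∃ γ ∈ Γ, h = γ * g
  isLocalBiholomorphism : IsLocalDiffeomorph 𝓘(ℂ, E) 𝓘(ℂ, E) ω π

/-- `θ 0, …, θ (n-1)` is a frame of smooth forms of type `(1, 0)` on `X` which comes from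
left-invariant forms on `G`. -/
structure IsInvariantCoframe {n : ℕ} {X : Type*} [TopologicalSpace X] [ChartedSpace E X]
    {G : Type*} [Group G] [TopologicalSpace G] [ChartedSpace E G]
    (π : G → X) (θ : Fin n → DiffForm E X 1) : Prop where
  smooth : ∀ j, IsSmoothForm (θ j)
  type : ∀ j x, HasType 1 0 (θ j x)
  frame : ∀ x, LinearIndependent ℂ (fun j => θ j x)
  leftInvariant : ∀ (g : G) (j : Fin n),
    pullback (fun h : G => g * h) (pullback π (θ j)) = pullback π (θ j)

/-- The structure equations, for `θ 0, …, θ (n-1)` of which `θ (n-1)` is the last: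
`d θ_l = 0` for `l < n - 1` and `d θ_(n-1) = ∑_{j < n-1} a_j θ_j ∧ θ̄_j`. -/
def StructureEquations {n : ℕ} {X : Type*} [TopologicalSpace X] [ChartedSpace E X]
    (θ : Fin n → DiffForm E X 1) (a : Fin n → ℝ) : Prop :=
  ∀ (l : Fin n) (x : X), extd (θ l) x =
    if (l : ℕ) + 1 = n then
      ∑ j ∈ Finset.univ.filter (fun j : Fin n => (j : ℕ) + 1 < n),
        (a j : ℂ) • wedge (θ j x) (conjForm (θ j) x)
    else 0

/-- The Heisenberg group of dimension `2 * m + 1`: the matrices with rows `(1, x, z)`,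
`(0, 1, y)`, `(0, 0, 1)`, where `x, y ∈ ℝᵐ` and `z ∈ ℝ`, in the coordinates `(x, y, z)`. -/
def HeisenbergGroup (m : ℕ) : Type := (Fin m → ℝ) × (Fin m → ℝ) × ℝ

instance (m : ℕ) : TopologicalSpace (HeisenbergGroup m) :=
  inferInstanceAs (TopologicalSpace ((Fin m → ℝ) × (Fin m → ℝ) × ℝ))

instance (m : ℕ) : Group (HeisenbergGroup m) where
  mul g h := (g.1 + h.1, g.2.1 + h.2.1, g.2.2 + h.2.2 + ∑ i, g.1 i * h.2.1 i)
  one := (0, 0, 0)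
  inv g := (-g.1, -g.2.1, -g.2.2 + ∑ i, g.1 i * g.2.1 i)
  mul_assoc g h k := by
    refine Prod.ext (add_assoc _ _ _) (Prod.ext (add_assoc _ _ _) ?_)
    change (g.2.2 + h.2.2 + ∑ i, g.1 i * h.2.1 i) + k.2.2 + ∑ i, (g.1 i + h.1 i) * k.2.1 i =
      g.2.2 + (h.2.2 + k.2.2 + ∑ i, h.1 i * k.2.1 i) + ∑ i, g.1 i * (h.2.1 i + k.2.1 i)
    simp only [add_mul, mul_add, Finset.sum_add_distrib]
    ring
  one_mul g := by
    refine Prod.ext (zero_add _) (Prod.ext (zero_add _) ?_)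
    change (0 : ℝ) + g.2.2 + ∑ i, (0 : ℝ) * g.2.1 i = g.2.2
    simp
  mul_one g := by
    refine Prod.ext (add_zero _) (Prod.ext (add_zero _) ?_)
    change g.2.2 + (0 : ℝ) + ∑ i, g.1 i * (0 : ℝ) = g.2.2
    simp
  inv_mul_cancel g := by
    refine Prod.ext (neg_add_cancel _) (Prod.ext (neg_add_cancel _) ?_)
    change (-g.2.2 + ∑ i, g.1 i * g.2.1 i) + g.2.2 + ∑ i, (-g.1 i) * g.2.1 i = 0
    simp only [neg_mul, Finset.sum_neg_distrib]
    ring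

end Nilmanifolds

end CplxGeom

end

open CplxGeom

open scoped Manifold ContDiff

/-! Put `n = N + 2` and give `ℂ^(N+2)` the product `g * h = g + h + (∑ a_j conj(g_j) h_j) e`, with
`e` the last basis vector and coefficients `1, …, 1, -N` on the other coordinates. Left translations
are complex affine, so the standard complex structure is left-invariant. The integrality of the
`a_j` makes the Gaussian integer points a cocompact lattice. An invariant coframe consists of the
`dz_j` for `j < n` and `ω = dz_n - ∑ a_j z̄_j dz_j`, with `dω = Ω = ∑ a_j dz_j ∧ dz̄_j`. The real
part of the cocycle is symmetric, hence a coboundary, and its imaginary part is a symplectic form;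
this gives Heisenberg times a line.

Both metrics are `(i/2)(B + ω ∧ ω̄)` with `B = S + cT`, where `S` is the sum of the first `N` terms
`dz_j ∧ dz̄_j` and `T` is the next one. Here `S^(N+1) = 0`, `T² = 0` and `Ω = S - N T`. As `ω ∧ ω̄`
has square zero and differential `Ω ∧ ω̄ + ω ∧ Ω`, up to constants `d F^(k+1)` is `B^k Ω (ω + ω̄)`
and `∂∂̄ F^(k+1)` is `B^k Ω²`. Everything reduces to identities in a commutative ring. The balanced
condition follows from `B^N Ω = 0`, which holds for `c = 1` because the `a_j` have sum zero
(`balanced_identity`). The astheno-Kähler condition follows from `B^(N-1) Ω² = 0`, a linear equation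
for `c` solved by `c = 2N/(N-1)` (`asthenoKahler_identity`). The same vanishing gives every
Gauduchon condition (`mul_add_pow_eq_zero`). The passage from forms to algebra rests on
`wedge_extForm` and `extDeriv_sum_smul_extForm`, and the passage from the group to the quotient on
`extd_descend`.

There is no Kähler metric because a multiple of the central torus fibre bounds, whereas a Kähler
form is positive on it. Concretely, a Kähler form is lifted to the group and averaged over the
centre; then `α(·, e)` is closed on the complex line of the first coordinate. Its integral around
the unit square vanishes by Green's theorem. But opposite sides are matched by lattice translations
that shear the tangent vectors by multiples of `ie`, so they differ by integrals of `α(e, ie) > 0`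
(`not_pos_of_closed`). -/

noncomputable section

namespace CplxGeom

/-! ### Alternating forms from the exterior algebra -/

section Exterior

open ExteriorAlgebra

variable {E : Type*} [NormedAddCommGroup E] [NormedSpace ℂ E]

/-- The alternating map sending complex-valued real functionals `φ₁, …, φ_r` to the form
`v ↦ det (φ_i (v_j))`. -/
def detForm (E : Type*) [NormedAddCommGroup E] [NormedSpace ℂ E] (r : ℕ) :
    (E →L[ℝ] ℂ) [⋀^Fin r]→ₗ[ℂ] (E [⋀^Fin r]→L[ℝ] ℂ) where
  toFun φ :=
    { toFun := fun v => (Matrix.of fun i j => φ i (v j)).det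
      map_update_add' := by
        intro inst v i x y
        have hinst : inst = instDecidableEqFin r := Subsingleton.elim _ _
        subst hinst
        have h : ∀ z : E, (Matrix.of fun k j => φ k (Function.update v i z j)) =
            (Matrix.of fun k j => φ k (v j)).updateCol i (fun k => φ k z) := by
          intro z; ext k j; by_cases hj : j = i
          · subst hj; simp
          · simp [Function.update_of_ne hj, Matrix.updateCol_ne hj]
        simp only [h, map_add]
        exact Matrix.det_updateCol_add _ _ _ _
      map_update_smul' := by
        intro inst v i c x
        have hinst : inst = instDecidableEqFin r := Subsingleton.elim _ _
        subst hinst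
        have h : ∀ z : E, (Matrix.of fun k j => φ k (Function.update v i z j)) =
            (Matrix.of fun k j => φ k (v j)).updateCol i (fun k => φ k z) := by
          intro z; ext k j; by_cases hj : j = i
          · subst hj; simp
          · simp [Function.update_of_ne hj, Matrix.updateCol_ne hj]
        simp only [h, map_smul, Complex.real_smul]
        exact Matrix.det_updateCol_smul _ _ _ _
      map_eq_zero_of_eq' := fun v i j hv hij =>
        Matrix.det_zero_of_column_eq hij fun k => by simp [hv]
      cont := by simp only [Matrix.det_apply']; fun_prop }
  map_update_add' := by
    intro inst φ i x y
    have hinst : inst = instDecidableEqFin r := Subsingleton.elim _ _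
    subst hinst
    ext v
    have h : ∀ z : E →L[ℝ] ℂ, (Matrix.of fun k j => Function.update φ i z k (v j)) =
        (Matrix.of fun k j => φ k (v j)).updateRow i (fun j => z (v j)) := by
      intro z; ext k j; by_cases hk : k = i
      · subst hk; simp
      · simp [Function.update_of_ne hk, Matrix.updateRow_ne hk]
    change Matrix.det (Matrix.of fun k j => Function.update φ i (x + y) k (v j)) =
      Matrix.det (Matrix.of fun k j => Function.update φ i x k (v j)) +
      Matrix.det (Matrix.of fun k j => Function.update φ i y k (v j))
    simp only [h]
    exact Matrix.det_updateRow_add _ _ _ _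
  map_update_smul' := by
    intro inst φ i c x
    have hinst : inst = instDecidableEqFin r := Subsingleton.elim _ _
    subst hinst
    ext v
    have h : ∀ z : E →L[ℝ] ℂ, (Matrix.of fun k j => Function.update φ i z k (v j)) =
        (Matrix.of fun k j => φ k (v j)).updateRow i (fun j => z (v j)) := by
      intro z; ext k j; by_cases hk : k = i
      · subst hk; simp
      · simp [Function.update_of_ne hk, Matrix.updateRow_ne hk]
    change Matrix.det (Matrix.of fun k j => Function.update φ i (c • x) k (v j)) =
      c • Matrix.det (Matrix.of fun k j => Function.update φ i x k (v j))
    simp only [h]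
    exact Matrix.det_updateRow_smul _ _ _ _
  map_eq_zero_of_eq' φ i j hφ hij := by
    ext v
    exact Matrix.det_zero_of_row_eq hij (by funext k; simp [hφ])

theorem detForm_apply {r : ℕ} (φ : Fin r → E →L[ℝ] ℂ) (v : Fin r → E) :
    detForm E r φ v = (Matrix.of fun i j => φ i (v j)).det := rfl

/-- The form of degree `r` given by the degree `r` part of an element of the exterior algebra on
the complex-valued real functionals. -/
def extForm (E : Type*) [NormedAddCommGroup E] [NormedSpace ℂ E] (r : ℕ) :
    ExteriorAlgebra ℂ (E →L[ℝ] ℂ) →ₗ[ℂ] (E [⋀^Fin r]→L[ℝ] ℂ) :=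
  liftAlternating
    (Pi.single (M := fun i => (E →L[ℝ] ℂ) [⋀^Fin i]→ₗ[ℂ] (E [⋀^Fin r]→L[ℝ] ℂ)) r (detForm E r))

theorem extForm_ιMulti {r : ℕ} (φ : Fin r → E →L[ℝ] ℂ) :
    extForm E r (ιMulti ℂ r φ) = detForm E r φ := by
  rw [extForm, liftAlternating_apply_ιMulti, Pi.single_eq_same]

theorem extForm_ιMulti_of_ne {r s : ℕ} (h : s ≠ r) (φ : Fin s → E →L[ℝ] ℂ) :
    extForm E r (ιMulti ℂ s φ) = 0 := by
  rw [extForm, liftAlternating_apply_ιMulti, Pi.single_eq_of_ne h]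
  rfl

theorem exterior_induction {P : ExteriorAlgebra ℂ (E →L[ℝ] ℂ) → Prop}
    (mul : ∀ r (φ : Fin r → E →L[ℝ] ℂ), P (ιMulti ℂ r φ)) (add : ∀ f g, P f → P g → P (f + g))
    (smul : ∀ (c : ℂ) f, P f → P (c • f)) (f : ExteriorAlgebra ℂ (E →L[ℝ] ℂ)) : P f := by
  have hf : f ∈ Submodule.span ℂ
      (Set.range fun x : Σ r, (Fin r → E →L[ℝ] ℂ) => ιMulti ℂ x.1 x.2) := by
    rw [ιMulti_span]; trivial
  induction hf using Submodule.span_induction with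
  | mem x hx => obtain ⟨⟨r, φ⟩, rfl⟩ := hx; exact mul r φ
  | zero => simpa using smul 0 _ (mul 0 ![])
  | add f g _ _ hf hg => exact add f g hf hg
  | smul c f _ hf => exact smul c f hf

theorem exterior_induction_homogeneous {p : ℕ} {P : ExteriorAlgebra ℂ (E →L[ℝ] ℂ) → Prop}
    (mul : ∀ (φ : Fin p → E →L[ℝ] ℂ), P (ιMulti ℂ p φ)) (zero : P 0)
    (add : ∀ f g, P f → P g → P (f + g))
    (smul : ∀ (c : ℂ) f, P f → P (c • f)) {f : ExteriorAlgebra ℂ (E →L[ℝ] ℂ)}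
    (hf : f ∈ ⋀[ℂ]^p (E →L[ℝ] ℂ)) : P f := by
  rw [← ιMulti_span_fixedDegree] at hf
  induction hf using Submodule.span_induction with
  | mem x hx => obtain ⟨φ, rfl⟩ := hx; exact mul φ
  | zero => exact zero
  | add f g _ _ hf hg => exact add f g hf hg
  | smul c f _ hf => exact smul c f hf

/-! ### The wedge product as multiplication in the exterior algebra -/

theorem wedge_apply {p q : ℕ} (a : E [⋀^Fin p]→L[ℝ] ℂ) (b : E [⋀^Fin q]→L[ℝ] ℂ)
    (v : Fin (p + q) → E) :
    wedge a b v = (1 / ((p.factorial : ℝ) * (q.factorial : ℝ))) •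
      ∑ σ : Equiv.Perm (Fin (p + q)), Equiv.Perm.sign σ •
        (a (fun i => v (σ (Fin.castAdd q i))) * b (fun i => v (σ (Fin.natAdd p i)))) := by
  change (1 / ((p.factorial : ℝ) * (q.factorial : ℝ))) •
    (ContinuousMultilinearMap.alternatization (tensorMul a b)) v = _
  rw [ContinuousMultilinearMap.alternatization_apply_apply]
  rfl

theorem wedge_add_left {p q : ℕ} (a a' : E [⋀^Fin p]→L[ℝ] ℂ) (b : E [⋀^Fin q]→L[ℝ] ℂ) :
    wedge (a + a') b = wedge a b + wedge a' b := by
  ext v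
  simp only [wedge_apply, ContinuousAlternatingMap.add_apply, add_mul, smul_add,
    Finset.sum_add_distrib]

theorem wedge_add_right {p q : ℕ} (a : E [⋀^Fin p]→L[ℝ] ℂ) (b b' : E [⋀^Fin q]→L[ℝ] ℂ) :
    wedge a (b + b') = wedge a b + wedge a b' := by
  ext v
  simp only [wedge_apply, ContinuousAlternatingMap.add_apply, mul_add, smul_add,
    Finset.sum_add_distrib]

theorem wedge_smul_left {p q : ℕ} (c : ℂ) (a : E [⋀^Fin p]→L[ℝ] ℂ) (b : E [⋀^Fin q]→L[ℝ] ℂ) :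
    wedge (c • a) b = c • wedge a b := by
  ext v
  simp only [wedge_apply, ContinuousAlternatingMap.smul_apply, Finset.smul_sum]
  refine Finset.sum_congr rfl fun σ _ => ?_
  simp only [Units.smul_def, zsmul_eq_mul, Complex.real_smul, smul_eq_mul]
  ring

theorem wedge_smul_right {p q : ℕ} (c : ℂ) (a : E [⋀^Fin p]→L[ℝ] ℂ) (b : E [⋀^Fin q]→L[ℝ] ℂ) :
    wedge a (c • b) = c • wedge a b := by
  ext v
  simp only [wedge_apply, ContinuousAlternatingMap.smul_apply, Finset.smul_sum]
  refine Finset.sum_congr rfl fun σ _ => ?_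
  simp only [Units.smul_def, zsmul_eq_mul, Complex.real_smul, smul_eq_mul]
  ring

theorem wedge_zero_left {p q : ℕ} (b : E [⋀^Fin q]→L[ℝ] ℂ) :
    wedge (0 : E [⋀^Fin p]→L[ℝ] ℂ) b = 0 := by
  ext v; simp [wedge_apply]

theorem wedge_zero_right {p q : ℕ} (a : E [⋀^Fin p]→L[ℝ] ℂ) :
    wedge a (0 : E [⋀^Fin q]→L[ℝ] ℂ) = 0 := by
  ext v; simp [wedge_apply]

/-- Laplace expansion: the wedge product of decomposable forms. -/
theorem wedge_detForm {p q : ℕ} (φ : Fin p → E →L[ℝ] ℂ) (ψ : Fin q → E →L[ℝ] ℂ) :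
    wedge (detForm E p φ) (detForm E q ψ) = detForm E (p + q) (Fin.append φ ψ) := by
  ext v
  -- A pair of permutations of the two blocks acts on all the indices through `s`. Reindexing by `σ
  -- * s τ` absorbs the two inner determinants, so each of the `p! q!` pairs contributes one full
  -- determinant, which cancels the normalization.
  let s : Equiv.Perm (Fin p) × Equiv.Perm (Fin q) → Equiv.Perm (Fin (p + q)) := fun τ =>
    finSumFinEquiv.permCongr (τ.1.sumCongr τ.2)
  let T : Equiv.Perm (Fin (p + q)) → ℂ := fun σ =>
    ((Equiv.Perm.sign σ : ℤ) : ℂ) * ∏ i, Fin.append φ ψ i (v (σ i))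
  have hdet : ∀ {r : ℕ} (χ : Fin r → E →L[ℝ] ℂ) (w : Fin r → E),
      detForm E r χ w =
        ∑ τ : Equiv.Perm (Fin r), ((Equiv.Perm.sign τ : ℤ) : ℂ) * ∏ i, χ i (w (τ i)) := by
    intro r χ w
    rw [detForm_apply, ← Matrix.det_transpose, Matrix.det_apply']
    rfl
  have hT : ∀ (σ : Equiv.Perm (Fin (p + q))) (τ : Equiv.Perm (Fin p) × Equiv.Perm (Fin q)),
      ((Equiv.Perm.sign σ : ℤ) : ℂ) *
        ((((Equiv.Perm.sign τ.1 : ℤ) : ℂ) * ∏ i, φ i (v (σ (Fin.castAdd q (τ.1 i))))) *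
        (((Equiv.Perm.sign τ.2 : ℤ) : ℂ) * ∏ i, ψ i (v (σ (Fin.natAdd p (τ.2 i)))))) =
      T (σ * s τ) := by
    intro σ τ
    have h1 : Equiv.Perm.sign (s τ) = Equiv.Perm.sign τ.1 * Equiv.Perm.sign τ.2 := by
      simp only [s, Equiv.Perm.sign_permCongr, Equiv.Perm.sign_sumCongr]
    have h2 : ∀ i, s τ (Fin.castAdd q i) = Fin.castAdd q (τ.1 i) := by
      intro i; simp [s, Equiv.permCongr_apply]
    have h3 : ∀ i, s τ (Fin.natAdd p i) = Fin.natAdd p (τ.2 i) := by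
      intro i; simp [s, Equiv.permCongr_apply]
    simp only [T, Equiv.Perm.sign_mul, h1, Fin.prod_univ_add, Fin.append_left, Fin.append_right,
      Equiv.Perm.mul_apply, h2, h3, Units.val_mul, Int.cast_mul]
    ring
  have hsum : ∑ σ : Equiv.Perm (Fin (p + q)), Equiv.Perm.sign σ •
        (detForm E p φ (fun i => v (σ (Fin.castAdd q i))) *
          detForm E q ψ (fun i => v (σ (Fin.natAdd p i)))) =
      ((p.factorial : ℂ) * (q.factorial : ℂ)) * ∑ σ, T σ := by
    have h1 : ∀ σ : Equiv.Perm (Fin (p + q)), Equiv.Perm.sign σ •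
        (detForm E p φ (fun i => v (σ (Fin.castAdd q i))) *
          detForm E q ψ (fun i => v (σ (Fin.natAdd p i)))) =
        ∑ τ : Equiv.Perm (Fin p) × Equiv.Perm (Fin q), T (σ * s τ) := by
      intro σ
      rw [hdet, hdet, Finset.sum_mul_sum, ← Finset.sum_product', Units.smul_def, zsmul_eq_mul,
        Finset.mul_sum]
      exact Finset.sum_congr rfl fun τ _ => hT σ τ
    rw [Finset.sum_congr rfl fun σ _ => h1 σ, Finset.sum_comm]
    have h2 : ∀ τ, ∑ σ, T (σ * s τ) = ∑ σ, T σ := fun τ =>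
      Fintype.sum_equiv (Equiv.mulRight (s τ)) _ _ fun σ => rfl
    rw [Finset.sum_congr rfl fun τ _ => h2 τ, Finset.sum_const, nsmul_eq_mul, Finset.card_univ,
      Fintype.card_prod, Fintype.card_perm, Fintype.card_perm, Fintype.card_fin, Fintype.card_fin]
    push_cast
    rfl
  have hp : (p.factorial : ℂ) ≠ 0 := by exact_mod_cast p.factorial_ne_zero
  have hq : (q.factorial : ℂ) ≠ 0 := by exact_mod_cast q.factorial_ne_zero
  rw [wedge_apply, hsum, hdet, Complex.real_smul]
  push_cast
  field_simp
  rfl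

theorem ιMulti_mul_ιMulti {p q : ℕ} (φ : Fin p → E →L[ℝ] ℂ) (ψ : Fin q → E →L[ℝ] ℂ) :
    ιMulti ℂ p φ * ιMulti ℂ q ψ = ιMulti ℂ (p + q) (Fin.append φ ψ) := by
  rw [ιMulti_apply, ιMulti_apply, ιMulti_apply, ← List.prod_append, ← List.ofFn_fin_append]
  congr 2
  funext i
  induction i using Fin.addCases <;> simp

/-- By bilinearity the claim reduces to products of functionals, where it is the Laplace expansion
`wedge_detForm`. Homogeneity is needed because `extForm E p` kills the components of other degrees.
-/
theorem wedge_extForm {p q : ℕ} {f g : ExteriorAlgebra ℂ (E →L[ℝ] ℂ)}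
    (hf : f ∈ ⋀[ℂ]^p (E →L[ℝ] ℂ)) (hg : g ∈ ⋀[ℂ]^q (E →L[ℝ] ℂ)) :
    wedge (extForm E p f) (extForm E q g) = extForm E (p + q) (f * g) := by
  refine exterior_induction_homogeneous (p := p)
    (P := fun f => wedge (extForm E p f) (extForm E q g) = extForm E (p + q) (f * g))
    (fun φ => ?_) ?_ (fun f f' h h' => ?_) (fun c f h => ?_) hf
  · refine exterior_induction_homogeneous (p := q)
      (P := fun g => wedge (extForm E p (ιMulti ℂ p φ)) (extForm E q g) =
        extForm E (p + q) (ιMulti ℂ p φ * g))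
      (fun ψ => ?_) ?_ (fun f f' h h' => ?_) (fun c f h => ?_) hg
    · rw [extForm_ιMulti, extForm_ιMulti, wedge_detForm, ιMulti_mul_ιMulti, extForm_ιMulti]
    · rw [map_zero, wedge_zero_right, mul_zero, map_zero]
    · rw [map_add, wedge_add_right, h, h', mul_add, map_add]
    · rw [map_smul, wedge_smul_right, h, mul_smul_comm, map_smul]
  · rw [map_zero, wedge_zero_left, zero_mul, map_zero]
  · rw [map_add, wedge_add_left, h, h', add_mul, map_add]
  · rw [map_smul, wedge_smul_left, h, smul_mul_assoc, map_smul]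

theorem extForm_one : extForm E 0 1 = ContinuousAlternatingMap.constOfIsEmpty ℝ E (Fin 0) 1 := by
  rw [← ιMulti_zero_apply (R := ℂ) (M := E →L[ℝ] ℂ) ![], extForm_ιMulti]
  ext v
  simp [detForm_apply]

theorem wedgePow_extForm {f : ExteriorAlgebra ℂ (E →L[ℝ] ℂ)} (hf : f ∈ ⋀[ℂ]^2 (E →L[ℝ] ℂ)) (k : ℕ) :
    f ^ k ∈ ⋀[ℂ]^(2 * k) (E →L[ℝ] ℂ) ∧
      wedgePow (extForm E 2 f) k = extForm E (2 * k) (f ^ k) := by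
  induction k with
  | zero => exact ⟨by simp only [pow_zero, mul_zero]; exact (SetLike.GradedOne.one_mem (A := fun i => ⋀[ℂ]^i (E →L[ℝ] ℂ))),
      by rw [pow_zero]; exact extForm_one.symm⟩
  | succ k ih =>
    refine ⟨?_, ?_⟩
    · rw [pow_succ]
      exact SetLike.mul_mem_graded (A := fun i => ⋀[ℂ]^i (E →L[ℝ] ℂ)) ih.1 hf
    · change wedge (wedgePow (extForm E 2 f) k) (extForm E 2 f) = _
      rw [ih.2, wedge_extForm ih.1 hf, pow_succ]
      rfl

theorem extForm_ι (φ : E →L[ℝ] ℂ) (v : Fin 1 → E) : extForm E 1 (ι ℂ φ) v = φ (v 0) := by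
  have h : ι ℂ φ = ιMulti ℂ 1 ![φ] := by simp [ιMulti_apply]
  rw [h, extForm_ιMulti, detForm_apply]
  simp

theorem extForm_ι_mul_ι (φ ψ : E →L[ℝ] ℂ) (v : Fin 2 → E) :
    extForm E 2 (ι ℂ φ * ι ℂ ψ) v = φ (v 0) * ψ (v 1) - φ (v 1) * ψ (v 0) := by
  have h : ι ℂ φ * ι ℂ ψ = ιMulti ℂ 2 ![φ, ψ] := by simp [ιMulti_apply]
  rw [h, extForm_ιMulti, detForm_apply]
  simp [Matrix.det_fin_two]

theorem ι_mem (φ : E →L[ℝ] ℂ) : ι ℂ φ ∈ ⋀[ℂ]^1 (E →L[ℝ] ℂ) := by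
  rw [show ⋀[ℂ]^1 (E →L[ℝ] ℂ) = LinearMap.range (ι ℂ) from pow_one _]
  exact LinearMap.mem_range_self _ _

/-- The complex-linear map `φ ↦ φ ∘ A` on complex-valued real functionals. -/
def dualMap (A : E →L[ℝ] E) : (E →L[ℝ] ℂ) →ₗ[ℂ] (E →L[ℝ] ℂ) where
  toFun φ := φ.comp A
  map_add' _ _ := rfl
  map_smul' _ _ := rfl

/-- Turns left invariance and type, both conditions on a linear change of arguments, into equations
for an algebra endomorphism, which can be checked on generators. -/
theorem extForm_comp {r : ℕ} (f : ExteriorAlgebra ℂ (E →L[ℝ] ℂ)) (A : E →L[ℝ] E) :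
    (extForm E r f).compContinuousLinearMap A = extForm E r (map (dualMap A) f) := by
  induction f using exterior_induction with
  | add f g hf hg =>
    rw [map_add, map_add, map_add, ← hf, ← hg]; rfl
  | smul c f hf =>
    rw [map_smul, map_smul, map_smul, ← hf]; rfl
  | mul s φ =>
    rw [map_apply_ιMulti]
    by_cases h : s = r
    · subst h
      rw [extForm_ιMulti, extForm_ιMulti]
      rfl
    · rw [extForm_ιMulti_of_ne h, extForm_ιMulti_of_ne h]; rfl

/-- On a product of functionals this is the expansion of a determinant along its first row, the row
of `l`. -/
theorem alternatizeUncurryFin_smulRight_extForm {r : ℕ} (l : E →L[ℝ] ℂ)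
    (f : ExteriorAlgebra ℂ (E →L[ℝ] ℂ)) :
    ContinuousAlternatingMap.alternatizeUncurryFin (l.smulRight (extForm E r f)) =
      extForm E (r + 1) (ι ℂ l * f) := by
  induction f using exterior_induction with
  | add f g hf hg =>
    rw [mul_add, map_add, map_add, ← hf, ← hg,
      ← ContinuousAlternatingMap.alternatizeUncurryFin_add]
    congr 1
    ext
    simp
  | smul c f hf =>
    rw [mul_smul_comm, map_smul, map_smul, ← hf,
      ← ContinuousAlternatingMap.alternatizeUncurryFin_smul]
    congr 1
    ext v w
    simp only [ContinuousLinearMap.smulRight_apply, ContinuousAlternatingMap.smul_apply,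
      smul_apply, smul_eq_mul]
    ring
  | mul s φ =>
    have h1 : ι ℂ l * ιMulti ℂ s φ = ιMulti ℂ (s + 1) (Fin.cons l φ) := by
      simp [ιMulti_succ_apply, Matrix.vecTail, Function.comp_def]
    rw [h1]
    by_cases h : s = r
    · subst h
      rw [extForm_ιMulti, extForm_ιMulti]
      ext v
      rw [ContinuousAlternatingMap.alternatizeUncurryFin_apply, detForm_apply,
        Matrix.det_succ_row_zero]
      refine Finset.sum_congr rfl fun j _ => ?_
      simp only [ContinuousLinearMap.smulRight_apply, ContinuousAlternatingMap.smul_apply,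
        detForm_apply, smul_eq_mul, Matrix.of_apply, Fin.cons_zero]
      rw [zsmul_eq_mul]
      push_cast
      rw [mul_assoc]
      rfl
    · rw [extForm_ιMulti_of_ne h, extForm_ιMulti_of_ne (by omega)]
      ext v
      rw [ContinuousAlternatingMap.alternatizeUncurryFin_apply]
      simp

/-- The exterior derivative of a form with coefficients with respect to constant forms. -/
theorem extDeriv_sum_smul_extForm {r : ℕ} {κ : Type*} (s : Finset κ) (c : κ → E → ℂ)
    (f : κ → ExteriorAlgebra ℂ (E →L[ℝ] ℂ)) (y : E)
    (hc : ∀ i ∈ s, DifferentiableAt ℝ (c i) y) :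
    extDeriv (fun y => ∑ i ∈ s, c i y • extForm E r (f i)) y =
      ∑ i ∈ s, extForm E (r + 1) (ι ℂ (fderiv ℝ (c i) y) * f i) := by
  have h : HasFDerivAt (fun y => ∑ i ∈ s, c i y • extForm E r (f i))
      (∑ i ∈ s, (fderiv ℝ (c i) y).smulRight (extForm E r (f i))) y :=
    HasFDerivAt.fun_sum fun i hi =>
      (((ContinuousLinearMap.id ℝ ℂ).smulRight (extForm E r (f i))).hasFDerivAt).comp y
        (hc i hi).hasFDerivAt
  rw [extDeriv, h.fderiv, ← ContinuousAlternatingMap.alternatizeUncurryFinCLM_apply, map_sum]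
  refine Finset.sum_congr rfl fun i _ => ?_
  rw [ContinuousAlternatingMap.alternatizeUncurryFinCLM_apply,
    alternatizeUncurryFin_smulRight_extForm]

end Exterior

/-! ### The nilpotent group -/

section NilGroup

/-- The coefficients `1, …, 1, -N, 0` of the structure equations, the last one being irrelevant. -/
def coefInt (N : ℕ) (j : Fin (N + 2)) : ℤ :=
  if (j : ℕ) < N then 1 else if (j : ℕ) = N then -N else 0

def coef (N : ℕ) (j : Fin (N + 2)) : ℝ := coefInt N j

theorem coef_last (N : ℕ) : coef N (Fin.last (N + 1)) = 0 := by
  simp [coef, coefInt]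

theorem coef_ne_zero {N : ℕ} (hN : N ≠ 0) {j : Fin (N + 2)} (hj : (j : ℕ) + 1 < N + 2) :
    coef N j ≠ 0 := by
  unfold coef coefInt
  split_ifs with h1 h2
  · simp
  · simpa using hN
  · omega

theorem sum_coef (N : ℕ) :
    ∑ j ∈ Finset.univ.filter (fun j : Fin (N + 2) => (j : ℕ) + 1 < N + 2), coef N j = 0 := by
  have h : ∑ j ∈ Finset.univ.filter (fun j : Fin (N + 2) => (j : ℕ) + 1 < N + 2), coef N j =
      ∑ j, coef N j := by
    refine Finset.sum_subset (Finset.filter_subset _ _) fun j _ hj => ?_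
    have : j = Fin.last (N + 1) := by
      ext; simp at hj; simp; omega
    rw [this, coef_last]
  rw [h, Fin.sum_univ_castSucc, Fin.sum_univ_castSucc, coef_last]
  simp [coef, coefInt]

variable {N : ℕ}

/-- The last vector of the standard basis. -/
def lastVec (N : ℕ) : Fin (N + 2) → ℂ := Pi.single (Fin.last (N + 1)) 1

@[simp] theorem lastVec_last : lastVec N (Fin.last (N + 1)) = 1 := by simp [lastVec]

theorem lastVec_of_ne {j : Fin (N + 2)} (h : j ≠ Fin.last (N + 1)) : lastVec N j = 0 := by
  simp [lastVec, h]

@[simp] theorem lastVec_castSucc (j : Fin (N + 1)) : lastVec N j.castSucc = 0 :=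
  lastVec_of_ne (Fin.castSucc_lt_last j).ne

/-- The functional `h ↦ ∑ a_j conj(g_j) h_j`. -/
def cocycle (g : Fin (N + 2) → ℂ) : (Fin (N + 2) → ℂ) →L[ℂ] ℂ :=
  ∑ j, ((coef N j : ℂ) * starRingEnd ℂ (g j)) • ContinuousLinearMap.proj j

theorem cocycle_apply (g h : Fin (N + 2) → ℂ) :
    cocycle g h = ∑ j, (coef N j : ℂ) * starRingEnd ℂ (g j) * h j := by
  simp [cocycle]

theorem cocycle_add (g h : Fin (N + 2) → ℂ) : cocycle (g + h) = cocycle g + cocycle h := by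
  ext v
  simp [cocycle_apply, mul_add, add_mul, Finset.sum_add_distrib]

theorem cocycle_neg (g : Fin (N + 2) → ℂ) : cocycle (-g) = -cocycle g := by
  ext v
  simp [cocycle_apply]

theorem cocycle_zero : cocycle (0 : Fin (N + 2) → ℂ) = 0 := by
  ext v
  simp [cocycle_apply]

/-- The coefficient of the last coordinate is `0`. Together with `cocycle_lastVec` this says that
the cocycle ignores the last axis in both arguments, so that axis is central. -/
theorem cocycle_smul_lastVec (c : ℂ) : cocycle (c • lastVec N) = 0 := by
  ext v
  simp [cocycle_apply, Fin.sum_univ_castSucc, coef_last]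

@[simp] theorem cocycle_lastVec (g : Fin (N + 2) → ℂ) : cocycle g (lastVec N) = 0 := by
  simp [cocycle_apply, Fin.sum_univ_castSucc, coef_last]

/-- The differential of the left translation by `g`. -/
def leftLin (g : Fin (N + 2) → ℂ) : (Fin (N + 2) → ℂ) →L[ℂ] (Fin (N + 2) → ℂ) :=
  ContinuousLinearMap.id ℂ _ + (cocycle g).smulRight (lastVec N)

theorem leftLin_apply (g v : Fin (N + 2) → ℂ) : leftLin g v = v + cocycle g v • lastVec N := rfl

theorem leftLin_zero : leftLin (0 : Fin (N + 2) → ℂ) = ContinuousLinearMap.id ℂ _ := by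
  ext v : 1
  simp [leftLin_apply, cocycle_zero]

/-- The complex nilpotent Lie group: `ℂ^(N+2)` with the product
`g * h = g + h + (∑ a_j conj(g_j) h_j) e_last`. -/
def NilGroup (N : ℕ) : Type := Fin (N + 2) → ℂ

instance : TopologicalSpace (NilGroup N) := inferInstanceAs (TopologicalSpace (Fin (N + 2) → ℂ))
instance : ChartedSpace (Fin (N + 2) → ℂ) (NilGroup N) :=
  inferInstanceAs (ChartedSpace (Fin (N + 2) → ℂ) (Fin (N + 2) → ℂ))
instance : T2Space (NilGroup N) := inferInstanceAs (T2Space (Fin (N + 2) → ℂ))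
instance : LocallyCompactSpace (NilGroup N) :=
  inferInstanceAs (LocallyCompactSpace (Fin (N + 2) → ℂ))
instance : SecondCountableTopology (NilGroup N) :=
  inferInstanceAs (SecondCountableTopology (Fin (N + 2) → ℂ))
instance : ContractibleSpace (NilGroup N) :=
  inferInstanceAs (ContractibleSpace (Fin (N + 2) → ℂ))

/-- The correction along `lastVec` is invisible to the cocycle, which is therefore additive along
products. Associativity of the group law is a consequence. -/
theorem leftLin_add_leftLin (g h : Fin (N + 2) → ℂ) :
    leftLin (g + leftLin g h) = (leftLin g).comp (leftLin h) := by
  have h0 : cocycle (g + leftLin g h) = cocycle g + cocycle h := by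
    rw [leftLin_apply, ← add_assoc, cocycle_add, cocycle_smul_lastVec, cocycle_add, add_zero]
  ext v : 1
  rw [leftLin_apply, h0, ContinuousLinearMap.comp_apply, leftLin_apply g, leftLin_apply h v, map_add,
    map_smul, cocycle_lastVec, add_apply, smul_zero, add_zero, add_smul]
  abel

/-- The product of the group. -/
def nilMul (g h : Fin (N + 2) → ℂ) : Fin (N + 2) → ℂ := g + leftLin g h

/-- The inverse of the group. -/
def nilInv (g : Fin (N + 2) → ℂ) : Fin (N + 2) → ℂ := -leftLin (-g) g

theorem leftLin_nilMul (g h : Fin (N + 2) → ℂ) :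
    leftLin (nilMul g h) = (leftLin g).comp (leftLin h) := leftLin_add_leftLin g h

theorem nilMul_assoc (g h k : Fin (N + 2) → ℂ) :
    nilMul (nilMul g h) k = nilMul g (nilMul h k) := by
  rw [nilMul, leftLin_nilMul, nilMul, nilMul, nilMul, map_add, add_assoc]
  rfl

theorem nilInv_nilMul (g : Fin (N + 2) → ℂ) : nilMul (nilInv g) g = 0 := by
  have h : cocycle (nilInv g) = cocycle (-g) := by
    rw [nilInv, leftLin_apply, cocycle_neg, cocycle_add, cocycle_smul_lastVec, cocycle_neg,
      add_zero]
  rw [nilMul, leftLin_apply, h, nilInv, leftLin_apply]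
  abel

theorem zero_nilMul (g : Fin (N + 2) → ℂ) : nilMul 0 g = g := by
  rw [nilMul, leftLin_zero, zero_add]; rfl

theorem nilMul_zero (g : Fin (N + 2) → ℂ) : nilMul g 0 = g := by
  rw [nilMul, map_zero, add_zero]

theorem nilMul_apply (g h : Fin (N + 2) → ℂ) (j : Fin (N + 2)) :
    nilMul g h j =
      g j + h j + (∑ i, (coef N i : ℂ) * starRingEnd ℂ (g i) * h i) * lastVec N j := by
  rw [nilMul, leftLin_apply, cocycle_apply]
  simp [add_assoc]

theorem nilInv_apply (g : Fin (N + 2) → ℂ) (j : Fin (N + 2)) :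
    nilInv g j =
      -(g j + (∑ i, (coef N i : ℂ) * starRingEnd ℂ (-g i) * g i) * lastVec N j) := by
  rw [nilInv, leftLin_apply, cocycle_apply]
  simp

instance : Group (NilGroup N) where
  mul := nilMul
  one := (0 : Fin (N + 2) → ℂ)
  inv := nilInv
  mul_assoc := nilMul_assoc
  one_mul := zero_nilMul
  mul_one := nilMul_zero
  inv_mul_cancel g := nilInv_nilMul g

theorem NilGroup.mul_apply (g h : NilGroup N) (j : Fin (N + 2)) :
    (g * h : NilGroup N) j =
      g j + h j + (∑ i, (coef N i : ℂ) * starRingEnd ℂ (g i) * h i) * lastVec N j :=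
  nilMul_apply g h j

theorem NilGroup.inv_apply (g : NilGroup N) (j : Fin (N + 2)) :
    (g⁻¹ : NilGroup N) j =
      -(g j + (∑ i, (coef N i : ℂ) * starRingEnd ℂ (-g i) * g i) * lastVec N j) :=
  nilInv_apply g j

theorem NilGroup.mul_castSucc (g h : NilGroup N) (j : Fin (N + 1)) :
    (g * h : NilGroup N) j.castSucc = g j.castSucc + h j.castSucc := by
  simp [NilGroup.mul_apply]

theorem NilGroup.mul_last (g h : NilGroup N) :
    (g * h : NilGroup N) (Fin.last (N + 1)) = g (Fin.last (N + 1)) + h (Fin.last (N + 1)) +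
      ∑ i : Fin (N + 1), (coef N i.castSucc : ℂ) * starRingEnd ℂ (g i.castSucc) * h i.castSucc := by
  simp [NilGroup.mul_apply, Fin.sum_univ_castSucc, coef_last]

/-! ### Lie group structure and nilpotency -/

theorem contDiff_mul :
    ContDiff ℝ ∞ (fun p : (Fin (N + 2) → ℂ) × (Fin (N + 2) → ℂ) => nilMul p.1 p.2) := by
  have h : (fun p : (Fin (N + 2) → ℂ) × (Fin (N + 2) → ℂ) => nilMul p.1 p.2) =
      fun p => p.1 + (p.2 +
        (∑ j, (coef N j : ℂ) * Complex.conjCLE (p.1 j) * p.2 j) • lastVec N) := by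
    funext p
    rw [nilMul, leftLin_apply, cocycle_apply]
    rfl
  rw [h]
  fun_prop

theorem contDiff_inv :
    ContDiff ℝ ∞ (fun g : Fin (N + 2) → ℂ => nilInv g) := by
  have h : (fun g : Fin (N + 2) → ℂ => nilInv g) =
      fun g => -(g + (∑ j, (coef N j : ℂ) * Complex.conjCLE (-g j) * g j) • lastVec N) := by
    funext p
    rw [nilInv, leftLin_apply, cocycle_apply]
    rfl
  rw [h]
  fun_prop

/-- The product involves the conjugates of the coordinates of its left factor, so the Lie group is
only real. Left translations are nevertheless holomorphic. -/
instance : LieGroup 𝓘(ℝ, Fin (N + 2) → ℂ) ∞ (NilGroup N) where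
  compatible := HasGroupoid.compatible (M := Fin (N + 2) → ℂ)
    (G := contDiffGroupoid ∞ 𝓘(ℝ, Fin (N + 2) → ℂ))
  contMDiff_mul := by
    have h : ContMDiff (𝓘(ℝ, Fin (N + 2) → ℂ).prod 𝓘(ℝ, Fin (N + 2) → ℂ))
        𝓘(ℝ, (Fin (N + 2) → ℂ) × (Fin (N + 2) → ℂ)) ∞
        (fun p : (Fin (N + 2) → ℂ) × (Fin (N + 2) → ℂ) => (p.1, p.2)) :=
      contMDiff_fst.prodMk_space contMDiff_snd
    exact contDiff_mul.contMDiff.comp h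
  contMDiff_inv := contDiff_inv.contMDiff

instance : IsTopologicalGroup (NilGroup N) where
  continuous_mul := contDiff_mul.continuous
  continuous_inv := contDiff_inv.continuous

theorem contDiff_nilMul_left (g : Fin (N + 2) → ℂ) :
    ContDiff ℂ ω (nilMul g) :=
  contDiff_const.add (leftLin g).contDiff

theorem hasFDerivAt_nilMul (g h : Fin (N + 2) → ℂ) :
    HasFDerivAt (nilMul g) (leftLin g) h :=
  ((leftLin g).hasFDerivAt).const_add g

/-- The projection of the group to the coordinates other than the last one. -/
def NilGroup.toBase (N : ℕ) : NilGroup N →* Multiplicative (Fin (N + 1) → ℂ) where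
  toFun g := Multiplicative.ofAdd fun j => g j.castSucc
  map_one' := rfl
  map_mul' g h := by
    change Multiplicative.ofAdd (fun j : Fin (N + 1) => (g * h : NilGroup N) j.castSucc) =
      Multiplicative.ofAdd ((fun j : Fin (N + 1) => g j.castSucc) +
        fun j : Fin (N + 1) => h j.castSucc)
    congr 1
    funext j
    exact NilGroup.mul_castSucc g h j

instance : Group.IsNilpotent (NilGroup N) := by
  -- The kernel of the projection to the abelian base group is the last axis, which is central.
  refine Subgroup.isNilpotent_of_ker_le_center (NilGroup.toBase N) (fun g hg => ?_)
  have h0 : ∀ j : Fin (N + 1), g j.castSucc = 0 := fun j => congrFun (show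
    (fun j : Fin (N + 1) => g j.castSucc) = 0 from hg) j
  rw [Subgroup.mem_center_iff]
  intro h
  funext j
  induction j using Fin.lastCases with
  | last => rw [NilGroup.mul_last, NilGroup.mul_last]; simp [h0, add_comm]
  | cast j => rw [NilGroup.mul_castSucc, NilGroup.mul_castSucc, add_comm]

/-- The isomorphism with the product of the Heisenberg group and the line. -/
def NilGroup.heisenbergEquiv (hN : N ≠ 0) :
    NilGroup N ≃ₜ* HeisenbergGroup (N + 1) × Multiplicative ℝ where
  -- The cocycle `a conj(z) w` has symmetric real part, the coboundary of `a |z|² / 2`, which is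
  -- subtracted. Its imaginary part is `a (x y' - y x')`; adding the quadratic term `a x y` to the
  -- coordinate turns it into `2 a x y'`, whence the factor `2 a` on the first Heisenberg
  -- coordinate.
  toFun g :=
    ((fun j => 2 * coef N j.castSucc * (g j.castSucc).re, fun j => (g j.castSucc).im,
      (g (Fin.last (N + 1))).im +
        ∑ j : Fin (N + 1), coef N j.castSucc * (g j.castSucc).re * (g j.castSucc).im),
     Multiplicative.ofAdd ((g (Fin.last (N + 1))).re - ∑ j : Fin (N + 1),
        coef N j.castSucc * ((g j.castSucc).re ^ 2 + (g j.castSucc).im ^ 2) / 2))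
  invFun p := Fin.snoc (α := fun _ => ℂ)
    (fun j => ⟨p.1.1 j / (2 * coef N j.castSucc), p.1.2.1 j⟩)
    ⟨Multiplicative.toAdd p.2 + ∑ j : Fin (N + 1),
        coef N j.castSucc * ((p.1.1 j / (2 * coef N j.castSucc)) ^ 2 + (p.1.2.1 j) ^ 2) / 2,
      p.1.2.2 - ∑ j : Fin (N + 1),
        coef N j.castSucc * (p.1.1 j / (2 * coef N j.castSucc)) * p.1.2.1 j⟩
  left_inv g := by
    have hc : ∀ j : Fin (N + 1), coef N j.castSucc ≠ 0 := fun j =>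
      coef_ne_zero hN (by simp only [Fin.val_castSucc]; omega)
    have hd : ∀ j : Fin (N + 1), 2 * coef N j.castSucc * (g j.castSucc).re /
        (2 * coef N j.castSucc) = (g j.castSucc).re := fun j => by
      have := hc j; field_simp
    funext j
    induction j using Fin.lastCases with
    | last => simp only [Fin.snoc_last, hd]; apply Complex.ext <;> simp
    | cast j => simp only [Fin.snoc_castSucc, hd]
  right_inv p := by
    obtain ⟨⟨x, y, s⟩, r⟩ := p
    have hc : ∀ j : Fin (N + 1), coef N j.castSucc ≠ 0 := fun j =>
      coef_ne_zero hN (by simp only [Fin.val_castSucc]; omega)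
    have hd : ∀ j : Fin (N + 1), 2 * coef N j.castSucc * (x j / (2 * coef N j.castSucc)) = x j :=
      fun j => by have := hc j; field_simp
    simp only [Fin.snoc_castSucc, Fin.snoc_last, hd, sub_add_cancel, add_sub_cancel_right]
    rfl
  map_mul' g h := by
    refine Prod.ext (Prod.ext ?_ (Prod.ext ?_ ?_)) ?_
    · funext j
      change 2 * coef N j.castSucc * ((g * h : NilGroup N) j.castSucc).re =
        2 * coef N j.castSucc * (g j.castSucc).re + 2 * coef N j.castSucc * (h j.castSucc).re
      rw [NilGroup.mul_castSucc, Complex.add_re, mul_add]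
    · funext j
      change ((g * h : NilGroup N) j.castSucc).im = (g j.castSucc).im + (h j.castSucc).im
      rw [NilGroup.mul_castSucc, Complex.add_im]
    · change ((g * h : NilGroup N) (Fin.last (N + 1))).im + ∑ j : Fin (N + 1), coef N j.castSucc *
          ((g * h : NilGroup N) j.castSucc).re * ((g * h : NilGroup N) j.castSucc).im =
        ((g (Fin.last (N + 1))).im +
          ∑ j : Fin (N + 1), coef N j.castSucc * (g j.castSucc).re * (g j.castSucc).im) +
        ((h (Fin.last (N + 1))).im +
          ∑ j : Fin (N + 1), coef N j.castSucc * (h j.castSucc).re * (h j.castSucc).im) +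
        ∑ j : Fin (N + 1), 2 * coef N j.castSucc * (g j.castSucc).re * (h j.castSucc).im
      simp only [NilGroup.mul_last, NilGroup.mul_castSucc, Complex.add_im, Complex.add_re,
        Complex.im_sum]
      have : ∀ a b c d e f : ℝ, a + b + c + d = a + e + (b + d - e) + c := by intros; ring
      rw [add_add_add_comm, add_assoc, add_assoc, add_assoc, add_assoc]
      congr 1
      congr 1
      rw [← Finset.sum_add_distrib, ← Finset.sum_add_distrib, ← Finset.sum_add_distrib]
      refine Finset.sum_congr rfl fun j _ => ?_
      simp only [Complex.mul_im, Complex.mul_re, Complex.conj_re, Complex.conj_im,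
        Complex.ofReal_re, Complex.ofReal_im]
      ring
    · change ((g * h : NilGroup N) (Fin.last (N + 1))).re - ∑ j : Fin (N + 1), coef N j.castSucc *
          (((g * h : NilGroup N) j.castSucc).re ^ 2 + ((g * h : NilGroup N) j.castSucc).im ^ 2) / 2 =
        ((g (Fin.last (N + 1))).re - ∑ j : Fin (N + 1), coef N j.castSucc *
          ((g j.castSucc).re ^ 2 + (g j.castSucc).im ^ 2) / 2) +
        ((h (Fin.last (N + 1))).re - ∑ j : Fin (N + 1), coef N j.castSucc *
          ((h j.castSucc).re ^ 2 + (h j.castSucc).im ^ 2) / 2)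
      simp only [NilGroup.mul_last, NilGroup.mul_castSucc, Complex.add_im, Complex.add_re,
        Complex.re_sum]
      rw [sub_add_sub_comm, ← Finset.sum_add_distrib, add_sub_assoc, ← Finset.sum_sub_distrib,
        sub_eq_add_neg, ← Finset.sum_neg_distrib]
      congr 1
      refine Finset.sum_congr rfl fun j _ => ?_
      simp only [Complex.mul_im, Complex.mul_re, Complex.conj_re, Complex.conj_im,
        Complex.ofReal_re, Complex.ofReal_im]
      ring
  continuous_toFun := by
    have h : ∀ j, Continuous fun g : NilGroup N => g j := fun j => continuous_apply j
    have hre : ∀ j, Continuous fun g : NilGroup N => (g j).re := fun j =>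
      Complex.continuous_re.comp (h j)
    have him : ∀ j, Continuous fun g : NilGroup N => (g j).im := fun j =>
      Complex.continuous_im.comp (h j)
    refine Continuous.prodMk (Continuous.prodMk ?_ (Continuous.prodMk ?_ ?_)) ?_
    · fun_prop
    · fun_prop
    · fun_prop
    · refine continuous_ofAdd.comp ?_
      fun_prop
  continuous_invFun := by
    have hx : ∀ j, Continuous fun p : HeisenbergGroup (N + 1) × Multiplicative ℝ => p.1.1 j :=
      fun j => (continuous_apply j).comp (continuous_fst.comp continuous_fst)
    have hy : ∀ j, Continuous fun p : HeisenbergGroup (N + 1) × Multiplicative ℝ => p.1.2.1 j :=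
      fun j => (continuous_apply j).comp (continuous_fst.comp (continuous_snd.comp continuous_fst))
    have hs : Continuous fun p : HeisenbergGroup (N + 1) × Multiplicative ℝ => p.1.2.2 :=
      continuous_snd.comp (continuous_snd.comp continuous_fst)
    have hr : Continuous fun p : HeisenbergGroup (N + 1) × Multiplicative ℝ =>
        Multiplicative.toAdd p.2 := continuous_toAdd.comp continuous_snd
    have hmk : ∀ (f g : HeisenbergGroup (N + 1) × Multiplicative ℝ → ℝ), Continuous f →
        Continuous g → Continuous fun p => (⟨f p, g p⟩ : ℂ) := fun f g hf hg =>
      Complex.equivRealProdCLM.symm.continuous.comp (hf.prodMk hg)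
    refine continuous_pi fun j => ?_
    induction j using Fin.lastCases with
    | last =>
      simp only [Fin.snoc_last]
      exact hmk _ _ (by fun_prop) (by fun_prop)
    | cast j =>
      simp only [Fin.snoc_castSucc]
      exact hmk _ _ (by fun_prop) (by fun_prop)

/-- The lattice of points with Gaussian integer coordinates. -/
def gaussianLattice (N : ℕ) : Subgroup (NilGroup N) where
  carrier := {g | ∀ j, g j ∈ GaussianInt.toComplex.range}
  one_mem' j := zero_mem _
  mul_mem' := by
    intro g h hg hh j
    rw [NilGroup.mul_apply]
    have hconj : ∀ z : ℂ, z ∈ GaussianInt.toComplex.range →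
        starRingEnd ℂ z ∈ GaussianInt.toComplex.range := by
      rintro _ ⟨w, rfl⟩
      exact ⟨star w, GaussianInt.toComplex_star w⟩
    -- Integrality of the structure coefficients is what keeps the cocycle term in the Gaussian
    -- integers.
    have hcoef : ∀ i, (coef N i : ℂ) ∈ GaussianInt.toComplex.range := fun i => by
      simp only [coef, Complex.ofReal_intCast]
      exact intCast_mem _ _
    have hlast : lastVec N j ∈ GaussianInt.toComplex.range := by
      unfold lastVec
      rcases eq_or_ne j (Fin.last (N + 1)) with rfl | h
      · simp
      · simp [h]
    exact add_mem (add_mem (hg j) (hh j)) (mul_mem (sum_mem fun i _ =>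
      mul_mem (mul_mem (hcoef i) (hconj _ (hg i))) (hh i)) hlast)
  inv_mem' := by
    intro g hg j
    have hconj : ∀ z : ℂ, z ∈ GaussianInt.toComplex.range →
        starRingEnd ℂ z ∈ GaussianInt.toComplex.range := by
      rintro _ ⟨w, rfl⟩
      exact ⟨star w, GaussianInt.toComplex_star w⟩
    have hcoef : ∀ i, (coef N i : ℂ) ∈ GaussianInt.toComplex.range := fun i => by
      simp only [coef, Complex.ofReal_intCast]
      exact intCast_mem _ _
    have hlast : lastVec N j ∈ GaussianInt.toComplex.range := by
      unfold lastVec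
      rcases eq_or_ne j (Fin.last (N + 1)) with rfl | h
      · simp
      · simp [h]
    rw [NilGroup.inv_apply]
    exact neg_mem (add_mem (hg j) (mul_mem (sum_mem fun i _ =>
      mul_mem (mul_mem (hcoef i) (hconj _ (neg_mem (hg i)))) (hg i)) hlast))

instance : DiscreteTopology (gaussianLattice N) := by
  refine discreteTopology_of_isOpen_singleton_one ?_
  have hb : IsOpen {g : gaussianLattice N | ∀ j, ‖g.1 j‖ < 1} := by
    simp only [Set.ofPred_forall]
    exact isOpen_iInter_of_finite fun j =>
      isOpen_lt ((continuous_apply (A := fun _ => ℂ) j).comp continuous_subtype_val).norm continuous_const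
  convert hb using 1
  ext g
  simp only [Set.mem_singleton_iff, Set.mem_ofPred_eq]
  constructor
  · rintro rfl
    intro j
    change ‖(0 : ℂ)‖ < 1
    simp
  · intro h
    refine Subtype.ext (funext fun j => ?_)
    change g.1 j = 0
    obtain ⟨w, hw⟩ := g.2 j
    have hj := h j
    rw [← hw] at hj ⊢
    have hn : Complex.normSq (GaussianInt.toComplex w) < 1 := by
      rw [Complex.normSq_eq_norm_sq]
      nlinarith [norm_nonneg (GaussianInt.toComplex w)]
    rw [← GaussianInt.intCast_real_norm] at hn
    have h1 : w.norm < 1 := by exact_mod_cast hn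
    have h2 : 0 ≤ w.norm := GaussianInt.norm_nonneg w
    have h3 : w = 0 := GaussianInt.norm_eq_zero.1 (by omega)
    rw [h3, map_zero]

instance : ProperlyDiscontinuousSMul (gaussianLattice N) (NilGroup N) :=
  Subgroup.properlyDiscontinuousSMul_of_tendsto_cofinite _
    (Subgroup.tendsto_coe_cofinite_of_discrete _ (SetLike.isDiscrete_iff_discreteTopology.2 inferInstance))

/-- Every complex number is at distance at most `2` from a Gaussian integer. -/
theorem exists_gaussian_near (z : ℂ) : ∃ w ∈ GaussianInt.toComplex.range, ‖w + z‖ ≤ 2 := by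
  refine ⟨GaussianInt.toComplex ⟨-⌊z.re⌋, -⌊z.im⌋⟩, ⟨_, rfl⟩, ?_⟩
  refine (Complex.norm_le_abs_re_add_abs_im _).trans ?_
  have h1 : |(GaussianInt.toComplex ⟨-⌊z.re⌋, -⌊z.im⌋⟩ + z).re| ≤ 1 := by
    simp only [Complex.add_re, GaussianInt.re_toComplex]
    rw [abs_le]; push_cast
    constructor <;> linarith [Int.floor_le z.re, Int.lt_floor_add_one z.re]
  have h2 : |(GaussianInt.toComplex ⟨-⌊z.re⌋, -⌊z.im⌋⟩ + z).im| ≤ 1 := by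
    simp only [Complex.add_im, GaussianInt.im_toComplex]
    rw [abs_le]; push_cast
    constructor <;> linarith [Int.floor_le z.im, Int.lt_floor_add_one z.im]
  linarith

theorem exists_lattice_mul_norm_le (g : NilGroup N) :
    ∃ γ ∈ gaussianLattice N, ∀ j, ‖(γ * g : NilGroup N) j‖ ≤ 2 := by
  choose w hw hwn using exists_gaussian_near
  let b : Fin (N + 1) → ℂ := fun j => w (g j.castSucc)
  -- The last coordinate of `γ` is chosen after the others, since the cocycle term it has to
  -- compensate depends on them.
  let c : ℂ := w (g (Fin.last (N + 1)) +
    ∑ i : Fin (N + 1), (coef N i.castSucc : ℂ) * starRingEnd ℂ (b i) * g i.castSucc)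
  let γ : NilGroup N := Fin.snoc (α := fun _ => ℂ) b c
  have h1 : ∀ j : Fin (N + 1), γ j.castSucc = b j := fun j => Fin.snoc_castSucc _ _ _
  have h2 : γ (Fin.last (N + 1)) = c := Fin.snoc_last _ _
  refine ⟨γ, fun j => ?_, ?_⟩
  · induction j using Fin.lastCases with
    | last => rw [h2]; exact hw _
    | cast j => rw [h1]; exact hw _
  · intro j
    induction j using Fin.lastCases with
    | last =>
      rw [NilGroup.mul_last, h2, add_assoc]
      simp only [h1]
      exact hwn _
    | cast j => rw [NilGroup.mul_castSucc, h1]; exact hwn _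

end NilGroup

/-! ### The nilmanifold -/

section Nilmanifold

variable {N : ℕ}

/-- A point with Gaussian integer coordinates. -/
def IsGaussian (g : Fin (N + 2) → ℂ) : Prop := ∀ j, g j ∈ GaussianInt.toComplex.range

/-- The quotient of the nilpotent group by the lattice of Gaussian integer points. -/
def Nilmanifold (N : ℕ) : Type :=
  Quotient (MulAction.orbitRel (gaussianLattice N) (NilGroup N))

instance : TopologicalSpace (Nilmanifold N) :=
  inferInstanceAs (TopologicalSpace (Quotient (MulAction.orbitRel _ _)))

instance : T2Space (Nilmanifold N) :=
  inferInstanceAs (T2Space (Quotient (MulAction.orbitRel (gaussianLattice N) (NilGroup N))))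

instance : ContinuousConstSMul (gaussianLattice N) (NilGroup N) where
  continuous_const_smul γ := continuous_const_mul γ.1

instance : SecondCountableTopology (Nilmanifold N) :=
  ContinuousConstSMul.secondCountableTopology (Γ := gaussianLattice N) (T := NilGroup N)

/-- The projection onto the nilmanifold. -/
def nilProj (g : Fin (N + 2) → ℂ) : Nilmanifold N :=
  Quotient.mk (MulAction.orbitRel (gaussianLattice N) (NilGroup N)) g

theorem nilProj_eq_iff (g h : Fin (N + 2) → ℂ) :
    nilProj g = nilProj h ↔ ∃ γ : Fin (N + 2) → ℂ, IsGaussian γ ∧ h = nilMul γ g := by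
  rw [eq_comm]
  constructor
  · intro H
    obtain ⟨γ, hγ⟩ := Quotient.exact (s := MulAction.orbitRel (gaussianLattice N) (NilGroup N)) H
    exact ⟨γ.1, γ.2, hγ.symm⟩
  · rintro ⟨γ, hγ, rfl⟩
    exact Quotient.sound (s := MulAction.orbitRel (gaussianLattice N) (NilGroup N)) ⟨⟨γ, hγ⟩, rfl⟩

theorem nilProj_nilMul {γ : Fin (N + 2) → ℂ} (hγ : IsGaussian γ) (g : Fin (N + 2) → ℂ) :
    nilProj (nilMul γ g) = nilProj g := ((nilProj_eq_iff _ _).2 ⟨γ, hγ, rfl⟩).symm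

theorem nilProj_surjective : Function.Surjective (nilProj (N := N)) := Quotient.mk_surjective

theorem continuous_nilProj : Continuous (nilProj (N := N)) := continuous_quotient_mk'

theorem isLocalHomeomorph_nilProj : IsLocalHomeomorph (nilProj (N := N)) :=
  (isQuotientCoveringMap_quotientMk_of_properlyDiscontinuousSMul (E := NilGroup N)
    (G := gaussianLattice N)).isCoveringMap.isLocalHomeomorph

instance : CompactSpace (Nilmanifold N) := by
  refine ⟨?_⟩
  have hK : IsCompact (Set.pi Set.univ fun _ : Fin (N + 2) => Metric.closedBall (0 : ℂ) 2) :=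
    isCompact_univ_pi fun _ => isCompact_closedBall _ _
  convert hK.image (continuous_nilProj (N := N)) using 1
  refine (Set.eq_univ_of_forall fun x => ?_).symm
  obtain ⟨g, rfl⟩ := nilProj_surjective x
  obtain ⟨γ, hγ, h⟩ := exists_lattice_mul_norm_le (N := N) g
  exact ⟨nilMul γ g, fun j _ => mem_closedBall_zero_iff.2 (h j), nilProj_nilMul hγ g⟩

instance : ConnectedSpace (Nilmanifold N) :=
  nilProj_surjective.connectedSpace continuous_nilProj

/-- Local inverses of the projection. -/
def nilChart (g : Fin (N + 2) → ℂ) : OpenPartialHomeomorph (Fin (N + 2) → ℂ) (Nilmanifold N) :=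
  (isLocalHomeomorph_nilProj g).choose

theorem mem_nilChart_source (g : Fin (N + 2) → ℂ) : g ∈ (nilChart g).source :=
  (isLocalHomeomorph_nilProj g).choose_spec.1

@[simp] theorem coe_nilChart (g : Fin (N + 2) → ℂ) : ⇑(nilChart g) = nilProj :=
  (isLocalHomeomorph_nilProj g).choose_spec.2.symm

/-- A representative of a point of the nilmanifold. -/
def nilRep (x : Nilmanifold N) : Fin (N + 2) → ℂ := Quotient.out x

@[simp] theorem nilProj_nilRep (x : Nilmanifold N) : nilProj (nilRep x) = x := Quotient.out_eq x

instance : ChartedSpace (Fin (N + 2) → ℂ) (Nilmanifold N) where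
  atlas := Set.range fun g => (nilChart g).symm
  chartAt x := (nilChart (nilRep x)).symm
  mem_chart_source x := by
    have := (nilChart (nilRep x)).map_source (mem_nilChart_source (nilRep x))
    rwa [coe_nilChart, nilProj_nilRep] at this
  chart_mem_atlas x := ⟨_, rfl⟩

theorem chartAt_eq (x : Nilmanifold N) :
    chartAt (Fin (N + 2) → ℂ) x = (nilChart (nilRep x)).symm := rfl

theorem chartAt_self (x : Nilmanifold N) : chartAt (Fin (N + 2) → ℂ) x x = nilRep x := by
  have := (nilChart (nilRep x)).left_inv (mem_nilChart_source (nilRep x))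
  rwa [coe_nilChart, nilProj_nilRep] at this

theorem coe_chartAt_symm (x : Nilmanifold N) :
    ⇑(chartAt (Fin (N + 2) → ℂ) x).symm = nilProj := by
  rw [chartAt_eq, OpenPartialHomeomorph.symm_symm, coe_nilChart]

/-- In charts the projection is locally a left translation by a lattice point. -/
theorem exists_nilChart_symm_eq (g y : Fin (N + 2) → ℂ) (hy : nilProj y ∈ (nilChart g).target) :
    ∃ γ, IsGaussian γ ∧ (nilChart g).symm (nilProj y) = nilMul γ y ∧
      ∀ᶠ z in nhds y, (nilChart g).symm (nilProj z) = nilMul γ z := by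
  have h1 : nilProj y = nilProj ((nilChart g).symm (nilProj y)) := by
    conv_lhs => rw [← (nilChart g).right_inv hy, coe_nilChart]
  obtain ⟨γ, hγ, h2⟩ := (nilProj_eq_iff _ _).1 h1
  have hmem : nilMul γ y ∈ (nilChart g).source := by
    rw [← h2]; exact (nilChart g).map_target hy
  have hev : ∀ᶠ z in nhds y, nilMul γ z ∈ (nilChart g).source :=
    (contDiff_nilMul_left γ).continuous.continuousAt.eventually_mem
      ((nilChart g).open_source.mem_nhds hmem)
  refine ⟨γ, hγ, h2, hev.mono fun z hz => ?_⟩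
  have := (nilChart g).left_inv hz
  rwa [coe_nilChart, nilProj_nilMul hγ] at this

/-- The transition maps are locally left translations by lattice points, which are complex affine.
-/
instance : IsManifold 𝓘(ℂ, Fin (N + 2) → ℂ) ω (Nilmanifold N) := by
  refine isManifold_of_contDiffOn _ _ _ ?_
  rintro _ _ ⟨g, rfl⟩ ⟨h, rfl⟩
  intro y hy
  simp only [mfld_simps] at hy
  obtain ⟨γ, -, h1, h2⟩ := exists_nilChart_symm_eq h y (by simpa using hy.2)
  refine ContDiffAt.contDiffWithinAt ?_
  refine ((contDiff_nilMul_left γ).contDiffAt).congr_of_eventuallyEq (h2.mono fun z hz => ?_)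
  simpa using hz

theorem isCompactComplexManifold_nilmanifold :
    IsCompactComplexManifold (Fin (N + 2) → ℂ) (Nilmanifold N) :=
  ⟨inferInstance, inferInstance, inferInstance, inferInstance, inferInstance⟩

theorem isLocalDiffeomorph_nilProj :
    IsLocalDiffeomorph 𝓘(ℂ, Fin (N + 2) → ℂ) 𝓘(ℂ, Fin (N + 2) → ℂ) ω (nilProj (N := N)) := by
  intro g
  have hatlas : (nilChart g).symm ∈ IsManifold.maximalAtlas 𝓘(ℂ, Fin (N + 2) → ℂ) ω
      (Nilmanifold N) := IsManifold.subset_maximalAtlas ⟨g, rfl⟩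
  refine ⟨⟨(nilChart g).toPartialEquiv, (nilChart g).open_source, (nilChart g).open_target,
    ?_, ?_⟩, mem_nilChart_source g, ?_⟩
  · exact contMDiffOn_symm_of_mem_maximalAtlas hatlas
  · exact contMDiffOn_of_mem_maximalAtlas hatlas
  · intro y _
    exact (congrFun (coe_nilChart g) y).symm

theorem isComplexNilmanifold_nilProj :
    IsComplexNilmanifold (Fin (N + 2) → ℂ) (gaussianLattice N)
      (nilProj : NilGroup N → Nilmanifold N) where
  lieGroup := inferInstance
  simplyConnected := inferInstance
  nilpotent := inferInstance
  complexManifold := inferInstanceAs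
    (IsManifold 𝓘(ℂ, Fin (N + 2) → ℂ) ω (Fin (N + 2) → ℂ))
  leftInvariant g := (contDiff_nilMul_left (N := N) g).contMDiff
  discrete := inferInstance
  isCompactComplexManifold := isCompactComplexManifold_nilmanifold
  surjective := nilProj_surjective
  fibers g h := nilProj_eq_iff g h
  isLocalBiholomorphism := isLocalDiffeomorph_nilProj

/-- The differential of the projection, read in the preferred chart. -/
theorem exists_mfderiv_nilProj (y : Fin (N + 2) → ℂ) :
    ∃ γ, IsGaussian γ ∧ nilRep (nilProj y) = nilMul γ y ∧
      mfderiv 𝓘(ℂ, Fin (N + 2) → ℂ) 𝓘(ℂ, Fin (N + 2) → ℂ) nilProj y = leftLin γ := by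
  have hy : nilProj y ∈ (nilChart (nilRep (nilProj y))).target :=
    mem_chart_source (Fin (N + 2) → ℂ) (nilProj y)
  obtain ⟨γ, hγ, h1, h2⟩ := exists_nilChart_symm_eq (nilRep (nilProj y)) y hy
  refine ⟨γ, hγ, ?_, HasMFDerivAt.mfderiv ⟨continuous_nilProj.continuousAt, ?_⟩⟩
  · rw [← h1, ← chartAt_eq, chartAt_self]
  · refine HasFDerivAt.hasFDerivWithinAt ?_
    refine (hasFDerivAt_nilMul γ y).congr_of_eventuallyEq (h2.mono fun z hz => ?_)
    simp only [writtenInExtChartAt, mfld_simps]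
    exact hz

/-! ### Forms on the nilmanifold from lattice-invariant forms -/

/-- A form on the group invariant under the left translation by `g`. -/
def IsLeftInvariantBy {r : ℕ} (g : Fin (N + 2) → ℂ)
    (α : DiffForm (Fin (N + 2) → ℂ) (Fin (N + 2) → ℂ) r) : Prop :=
  ∀ y, (α (nilMul g y)).compContinuousLinearMap ((leftLin g).restrictScalars ℝ) = α y

/-- The form on the nilmanifold with the given values at the representatives of its points. -/
def descend {r : ℕ} (α : DiffForm (Fin (N + 2) → ℂ) (Fin (N + 2) → ℂ) r) :
    DiffForm (Fin (N + 2) → ℂ) (Nilmanifold N) r := fun x => α (nilRep x)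

/-- In the preferred chart the differential of the projection at `y` is that of the left translation
by the lattice point taking `y` to its chosen representative. Invariance under this point is exactly
the claim. -/
theorem pullback_nilProj_descend {r : ℕ} {α : DiffForm (Fin (N + 2) → ℂ) (Fin (N + 2) → ℂ) r}
    (hα : ∀ γ, IsGaussian γ → IsLeftInvariantBy γ α) :
    pullback nilProj (descend α) = α := by
  funext y
  obtain ⟨γ, hγ, h1, h2⟩ := exists_mfderiv_nilProj y
  rw [pullback, h2, descend, h1]
  exact hα γ hγ y

/-- The inverse of every chart is, as a total function, `nilProj` itself, so the local expression is
`α` on the whole space and differentiation on the quotient is differentiation on the group. -/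
theorem inChart_descend {r : ℕ} {α : DiffForm (Fin (N + 2) → ℂ) (Fin (N + 2) → ℂ) r}
    (hα : ∀ γ, IsGaussian γ → IsLeftInvariantBy γ α) (x : Nilmanifold N) :
    inChart x (descend α) = α := by
  rw [inChart, coe_chartAt_symm, pullback_nilProj_descend hα]

theorem extd_descend {r : ℕ} {α : DiffForm (Fin (N + 2) → ℂ) (Fin (N + 2) → ℂ) r}
    (hα : ∀ γ, IsGaussian γ → IsLeftInvariantBy γ α) :
    extd (X := Nilmanifold N) (descend α) = descend (extDeriv α) := by
  funext x
  rw [extd, inChart_descend hα, chartAt_self]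
  rfl

theorem isSmoothForm_descend {r : ℕ} {α : DiffForm (Fin (N + 2) → ℂ) (Fin (N + 2) → ℂ) r}
    (hα : ∀ γ, IsGaussian γ → IsLeftInvariantBy γ α) (hs : ContDiff ℝ ∞ α) :
    IsSmoothForm (X := Nilmanifold N) (descend α) := by
  intro x
  rw [inChart_descend hα]
  exact hs.contDiffOn

theorem pullback_nilMul {r : ℕ} (g : Fin (N + 2) → ℂ)
    (α : DiffForm (Fin (N + 2) → ℂ) (Fin (N + 2) → ℂ) r) (y : Fin (N + 2) → ℂ) :
    pullback (nilMul g) α y =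
      (α (nilMul g y)).compContinuousLinearMap ((leftLin g).restrictScalars ℝ) := by
  rw [pullback, mfderiv_eq_fderiv, (hasFDerivAt_nilMul g y).fderiv]
  rfl

end Nilmanifold

/-! ### Types of forms -/

section Types

variable {E : Type*} [NormedAddCommGroup E] [NormedSpace ℂ E]

theorem rotate_add {r : ℕ} (c : ℂ) (α β : E [⋀^Fin r]→L[ℝ] ℂ) :
    rotate c (α + β) = rotate c α + rotate c β := rfl

theorem typePart_add {r : ℕ} (p : ℕ) (α β : E [⋀^Fin r]→L[ℝ] ℂ) :
    typePart p (α + β) = typePart p α + typePart p β := by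
  simp only [typePart, rotate_add, smul_add, Finset.sum_add_distrib]

theorem typePart_zero {r : ℕ} (p : ℕ) : typePart p (0 : E [⋀^Fin r]→L[ℝ] ℂ) = 0 := by
  have h := typePart_add p (0 : E [⋀^Fin r]→L[ℝ] ℂ) 0
  rw [add_zero] at h
  exact left_eq_add.1 h

variable {X : Type*} [TopologicalSpace X] [ChartedSpace E X]

theorem extd_zero {r : ℕ} : extd (fun _ => 0 : DiffForm E X r) = fun _ => 0 := by
  funext x
  have h : inChart x (fun _ => 0 : DiffForm E X r) = fun _ => 0 := rfl
  rw [extd, h, extDeriv, fderiv_fun_const]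
  exact (ContinuousAlternatingMap.alternatizeUncurryFinCLM ℝ E ℂ).map_zero

/-- When the type is the same at all points, the projection to any other type is the zero form
before differentiation. The sums defining `del` and `delbar` thus collapse to one term. -/
theorem typePart_extd_typePart {r p q : ℕ} {α : DiffForm E X r} (hα : ∀ x, HasType p q (α x))
    (s k : ℕ) (hs : s ≤ r) (x : X) :
    typePart k (extd (fun y => typePart s (α y)) x) =
      if s = p then typePart k (extd α x) else 0 := by
  split_ifs with h
  · subst h
    congr 2
    funext y
    exact typePart_of_hasType (hα y)
  · have h0 : (fun y => typePart s (α y)) = fun _ => 0 := by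
      funext y
      exact typePart_of_hasType_ne (hα y) hs h
    rw [h0, extd_zero, typePart_zero]

theorem delbar_of_hasType {r p q : ℕ} {α : DiffForm E X r} (hα : ∀ x, HasType p q (α x)) (x : X) :
    delbar α x = typePart p (extd α x) := by
  have hp : p + q = r := (hα x).1
  rw [delbar, Finset.sum_eq_single_of_mem p (Finset.mem_range.2 (by omega))]
  · rw [typePart_extd_typePart hα _ _ (by omega), if_pos rfl]
  · intro s hs hne
    rw [typePart_extd_typePart hα _ _ (by have := Finset.mem_range.1 hs; omega), if_neg hne]

theorem del_of_hasType {r p q : ℕ} {α : DiffForm E X r} (hα : ∀ x, HasType p q (α x)) (x : X) :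
    del α x = typePart (p + 1) (extd α x) := by
  have hp : p + q = r := (hα x).1
  rw [del, Finset.sum_eq_single_of_mem p (Finset.mem_range.2 (by omega))]
  · rw [typePart_extd_typePart hα _ _ (by omega), if_pos rfl]
  · intro s hs hne
    rw [typePart_extd_typePart hα _ _ (by have := Finset.mem_range.1 hs; omega), if_neg hne]

/-- The action of the multiplication by `c` on the exterior algebra. -/
def extRot (E : Type*) [NormedAddCommGroup E] [NormedSpace ℂ E] (c : ℂ) :
    ExteriorAlgebra ℂ (E →L[ℝ] ℂ) →ₐ[ℂ] ExteriorAlgebra ℂ (E →L[ℝ] ℂ) :=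
  ExteriorAlgebra.map (dualMap ((c • ContinuousLinearMap.id ℂ E).restrictScalars ℝ))

theorem hasType_extForm {r p q : ℕ} (hr : p + q = r) {f : ExteriorAlgebra ℂ (E →L[ℝ] ℂ)}
    (hf : ∀ c : ℂ, extRot E c f = (c ^ p * starRingEnd ℂ c ^ q) • f) :
    HasType p q (extForm E r f) := by
  refine ⟨hr, fun c => ?_⟩
  rw [rotate, extForm_comp, ← map_smul, ← hf]
  rfl

/-- The complex conjugate of a functional. -/
def conjFun (φ : E →L[ℝ] ℂ) : E →L[ℝ] ℂ := (Complex.conjCLE : ℂ →L[ℝ] ℂ).comp φ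

theorem conjFun_apply (φ : E →L[ℝ] ℂ) (v : E) : conjFun φ v = starRingEnd ℂ (φ v) := rfl

theorem dualMap_conjFun (A : E →L[ℝ] E) (φ : E →L[ℝ] ℂ) :
    dualMap A (conjFun φ) = conjFun (dualMap A φ) := rfl

theorem extRot_ι (c : ℂ) (φ : E →L[ℂ] ℂ) :
    extRot E c (ExteriorAlgebra.ι ℂ (φ.restrictScalars ℝ)) =
      c • ExteriorAlgebra.ι ℂ (φ.restrictScalars ℝ) := by
  rw [extRot, ExteriorAlgebra.map_apply_ι, ← map_smul]
  congr 1
  ext v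
  change φ (c • v) = c * φ v
  rw [map_smul, smul_eq_mul]

theorem extRot_ι_conjFun (c : ℂ) (φ : E →L[ℂ] ℂ) :
    extRot E c (ExteriorAlgebra.ι ℂ (conjFun (φ.restrictScalars ℝ))) =
      starRingEnd ℂ c • ExteriorAlgebra.ι ℂ (conjFun (φ.restrictScalars ℝ)) := by
  rw [extRot, ExteriorAlgebra.map_apply_ι, ← map_smul]
  congr 1
  ext v
  change starRingEnd ℂ (φ (c • v)) = starRingEnd ℂ c * starRingEnd ℂ (φ v)
  rw [map_smul, smul_eq_mul, map_mul]

/-- The element `φ ∧ φ̄` of the exterior algebra. -/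
def pairing (φ : E →L[ℝ] ℂ) : ExteriorAlgebra ℂ (E →L[ℝ] ℂ) :=
  ExteriorAlgebra.ι ℂ φ * ExteriorAlgebra.ι ℂ (conjFun φ)

theorem pairing_mem (φ : E →L[ℝ] ℂ) : pairing φ ∈ ⋀[ℂ]^2 (E →L[ℝ] ℂ) :=
  SetLike.mul_mem_graded (A := fun i => ⋀[ℂ]^i (E →L[ℝ] ℂ)) (ι_mem φ) (ι_mem (conjFun φ))

theorem extRot_pairing (c : ℂ) (φ : E →L[ℂ] ℂ) :
    extRot E c (pairing (φ.restrictScalars ℝ)) =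
      (c * starRingEnd ℂ c) • pairing (φ.restrictScalars ℝ) := by
  rw [pairing, map_mul, extRot_ι, extRot_ι_conjFun, smul_mul_smul_comm]

theorem map_pairing (A : E →L[ℝ] E) (φ : E →L[ℝ] ℂ) :
    ExteriorAlgebra.map (dualMap A) (pairing φ) = pairing (dualMap A φ) := by
  rw [pairing, map_mul, ExteriorAlgebra.map_apply_ι, ExteriorAlgebra.map_apply_ι]
  rfl

/-! ### The commutative ring containing the elements `φ ∧ φ̄` -/

theorem ι_mul_ι_swap (φ ψ : E →L[ℝ] ℂ) : ExteriorAlgebra.ι ℂ φ * ExteriorAlgebra.ι ℂ ψ =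
    -(ExteriorAlgebra.ι ℂ ψ * ExteriorAlgebra.ι ℂ φ) :=
  eq_neg_of_add_eq_zero_left (ExteriorAlgebra.ι_add_mul_swap φ ψ)

/-- Moving a generator past a product of two generators costs two signs. The metrics and `Ω`
therefore live in a commutative ring, where polynomial identities are available. -/
theorem ι_mul_ι_mem_center (φ ψ : E →L[ℝ] ℂ) :
    ExteriorAlgebra.ι ℂ φ * ExteriorAlgebra.ι ℂ ψ ∈
      Subalgebra.center ℂ (ExteriorAlgebra ℂ (E →L[ℝ] ℂ)) := by
  rw [Subalgebra.mem_center_iff]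
  intro z
  induction z using ExteriorAlgebra.induction with
  | algebraMap c => exact Algebra.commutes _ _
  | ι χ =>
    rw [← mul_assoc, ι_mul_ι_swap χ φ, neg_mul, mul_assoc, ι_mul_ι_swap χ ψ, mul_neg, neg_neg,
      mul_assoc]
  | mul a b ha hb => rw [mul_assoc, hb, ← mul_assoc, ha, mul_assoc]
  | add a b ha hb => rw [add_mul, ha, hb, mul_add]

theorem pairing_mul_self (φ : E →L[ℝ] ℂ) : pairing φ * pairing φ = 0 := by
  have h := (Subalgebra.mem_center_iff.1 (ι_mul_ι_mem_center φ (conjFun φ)))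
    (ExteriorAlgebra.ι ℂ φ)
  change (ExteriorAlgebra.ι ℂ φ * ExteriorAlgebra.ι ℂ (conjFun φ)) * pairing φ = 0
  rw [pairing, mul_assoc, ← mul_assoc (ExteriorAlgebra.ι ℂ (conjFun φ)),
    ι_mul_ι_swap (conjFun φ) φ, neg_mul, mul_neg, ← mul_assoc, ← mul_assoc,
    ExteriorAlgebra.ι_sq_zero, zero_mul, zero_mul, neg_zero]

/-- The center of the exterior algebra. -/
def ExtCenter (E : Type*) [NormedAddCommGroup E] [NormedSpace ℂ E] : Type _ :=
  Subalgebra.center ℂ (ExteriorAlgebra ℂ (E →L[ℝ] ℂ))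

instance : CommRing (ExtCenter E) :=
  inferInstanceAs (CommRing (Subalgebra.center ℂ (ExteriorAlgebra ℂ (E →L[ℝ] ℂ))))

instance : Algebra ℂ (ExtCenter E) :=
  inferInstanceAs (Algebra ℂ (Subalgebra.center ℂ (ExteriorAlgebra ℂ (E →L[ℝ] ℂ))))

/-- The inclusion of the center in the exterior algebra. -/
def extIncl : ExtCenter E →ₐ[ℂ] ExteriorAlgebra ℂ (E →L[ℝ] ℂ) :=
  (Subalgebra.center ℂ (ExteriorAlgebra ℂ (E →L[ℝ] ℂ))).val

theorem extIncl_injective : Function.Injective (extIncl (E := E)) := Subtype.val_injective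

theorem mul_extIncl_comm (h : ExtCenter E) (z : ExteriorAlgebra ℂ (E →L[ℝ] ℂ)) :
    z * extIncl h = extIncl h * z := Subalgebra.mem_center_iff.1 h.2 z

/-- The element `φ ∧ φ̄` as an element of the center of the exterior algebra. -/
def centerPairing (φ : E →L[ℝ] ℂ) : ExtCenter E := ⟨pairing φ, ι_mul_ι_mem_center _ _⟩

theorem extIncl_centerPairing (φ : E →L[ℝ] ℂ) : extIncl (centerPairing φ) = pairing φ := rfl

theorem centerPairing_sq (φ : E →L[ℝ] ℂ) : centerPairing φ ^ 2 = 0 := by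
  apply extIncl_injective
  rw [map_pow, sq, extIncl_centerPairing, pairing_mul_self, map_zero]

end Types

/-! ### Powers of sums of elements of square zero -/

section SquareZero

variable {R : Type*} [CommRing R]

theorem add_pow_succ_of_sq_eq_zero {S T : R} (hT : T ^ 2 = 0) (k : ℕ) :
    (S + T) ^ (k + 1) = S ^ (k + 1) + (k + 1 : ℕ) * (S ^ k * T) := by
  induction k with
  | zero => simp
  | succ k ih =>
    rw [pow_succ, ih]
    push_cast
    linear_combination (k + 1) * S ^ k * hT

/-- Every monomial of the expansion repeats one of the square-zero terms. -/
theorem sum_pow_card_succ_eq_zero {κ : Type*} (s : Finset κ) (t : κ → R)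
    (ht : ∀ i ∈ s, t i ^ 2 = 0) : (∑ i ∈ s, t i) ^ (s.card + 1) = 0 := by
  classical
  induction s using Finset.induction_on with
  | empty => simp
  | insert a s ha ih =>
    have h := ih fun i hi => ht i (Finset.mem_insert_of_mem hi)
    rw [Finset.sum_insert ha, add_comm, Finset.card_insert_of_notMem ha,
      add_pow_succ_of_sq_eq_zero (ht a (Finset.mem_insert_self _ _)), h, pow_succ, h]
    simp

/-- Modulo `T²` the power is `S^(M+1) + (M+1) S^M T`. The two terms in `S^(M+1) T` cancel, leaving
`S^(M+2)`. It is used with `N = M + 1`. -/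
theorem balanced_identity {S T : R} {M : ℕ} (hS : S ^ (M + 2) = 0) (hT : T ^ 2 = 0) :
    (S + T) ^ (M + 1) * (S - (M + 1 : ℕ) * T) = 0 := by
  rw [add_pow_succ_of_sq_eq_zero hT]
  linear_combination hS - ((M + 1 : ℕ) : R) ^ 2 * S ^ M * hT

/-- Modulo `T²` and `S^(M+3)` only `S^(M+2) T` survives, with coefficient `(M+1) c - 2(M+2)`. The
hypothesis on `c` is its vanishing. It is used with `N = M + 2`. -/
theorem asthenoKahler_identity {S T c : R} {M : ℕ} (hS : S ^ (M + 3) = 0) (hT : T ^ 2 = 0)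
    (hc : c * (M + 1 : ℕ) = 2 * (M + 2 : ℕ)) :
    (S + c * T) ^ (M + 1) * (S - (M + 2 : ℕ) * T) ^ 2 = 0 := by
  have hT' : (c * T) ^ 2 = 0 := by rw [mul_pow, hT, mul_zero]
  rw [add_pow_succ_of_sq_eq_zero hT']
  linear_combination hS + S ^ (M + 2) * T * hc +
    (S ^ (M + 1) * (M + 2 : ℕ) ^ 2 - 2 * (M + 1 : ℕ) * S ^ (M + 1) * c * (M + 2 : ℕ) +
      (M + 1 : ℕ) * S ^ M * c * (M + 2 : ℕ) ^ 2 * T) * hT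

/-- As `T² = 0`, expanding the last power uses at most one factor `T`, so at least `k + l - 1 ≥ q`
factors `B` remain beside `W`. -/
theorem mul_add_pow_eq_zero {B W T : R} {q k l : ℕ} (hT : T ^ 2 = 0) (hB : B ^ q * W = 0)
    (h : q + 1 ≤ k + l) : B ^ k * W * (B + T) ^ l = 0 := by
  have hB' : ∀ m, q ≤ m → B ^ m * W = 0 := by
    intro m hm
    obtain ⟨m, rfl⟩ := Nat.exists_eq_add_of_le hm
    rw [pow_add, mul_right_comm, hB, zero_mul]
  rcases Nat.eq_zero_or_pos l with rfl | hl
  · rw [pow_zero, mul_one, hB' k (by omega)]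
  · obtain ⟨l, rfl⟩ := Nat.exists_eq_add_of_le' hl
    rw [add_pow_succ_of_sq_eq_zero hT]
    have h1 := hB' (k + (l + 1)) (by omega)
    have h2 := hB' (k + l) (by omega)
    rw [pow_add] at h1 h2
    linear_combination h1 + ((l + 1 : ℕ) * T) * h2

end SquareZero

/-! ### Invariant forms on the nilmanifold -/

section InvariantForms

open ExteriorAlgebra

variable {N : ℕ}

/-- The left-invariant coframe on the group. -/
def coframe (j : Fin (N + 2)) (y : Fin (N + 2) → ℂ) : (Fin (N + 2) → ℂ) →L[ℂ] ℂ :=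
  (ContinuousLinearMap.proj j : (Fin (N + 2) → ℂ) →L[ℂ] ℂ).comp (leftLin (-y))

/-- The coframe, as real-linear functionals. -/
def coframeR (j : Fin (N + 2)) (y : Fin (N + 2) → ℂ) : (Fin (N + 2) → ℂ) →L[ℝ] ℂ :=
  (coframe j y).restrictScalars ℝ

/-- The coordinate functionals, as real-linear functionals. -/
def coordR (j : Fin (N + 2)) : (Fin (N + 2) → ℂ) →L[ℝ] ℂ :=
  (ContinuousLinearMap.proj j : (Fin (N + 2) → ℂ) →L[ℂ] ℂ).restrictScalars ℝ

theorem coframeR_apply (j : Fin (N + 2)) (y v : Fin (N + 2) → ℂ) :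
    coframeR j y v = v j - cocycle y v * lastVec N j := by
  change leftLin (-y) v j = _
  rw [leftLin_apply, cocycle_neg, Pi.add_apply, Pi.smul_apply, neg_apply, smul_eq_mul, neg_mul,
    sub_eq_add_neg]

theorem coframeR_castSucc (j : Fin (N + 1)) (y : Fin (N + 2) → ℂ) :
    coframeR j.castSucc y = coordR j.castSucc := by
  ext v
  rw [coframeR_apply, lastVec_castSucc, mul_zero, sub_zero]
  rfl

theorem coframeR_last_apply (y v : Fin (N + 2) → ℂ) :
    coframeR (Fin.last (N + 1)) y v = v (Fin.last (N + 1)) - cocycle y v := by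
  rw [coframeR_apply, lastVec_last, mul_one]

/-- The term `cocycle g v` that the translation adds to the last coordinate cancels the change of
the cocycle from `y` to `nilMul g y`. -/
theorem dualMap_coframeR (g y : Fin (N + 2) → ℂ) (j : Fin (N + 2)) :
    dualMap ((leftLin g).restrictScalars ℝ) (coframeR j (nilMul g y)) = coframeR j y := by
  ext v
  change coframeR j (nilMul g y) (leftLin g v) = coframeR j y v
  have h : cocycle (nilMul g y) = cocycle g + cocycle y := by
    rw [nilMul, leftLin_apply, ← add_assoc, cocycle_add, cocycle_smul_lastVec, cocycle_add,
      add_zero]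
  rw [coframeR_apply, coframeR_apply, h, leftLin_apply, map_add, map_smul, add_apply, add_apply,
    cocycle_lastVec, cocycle_lastVec, Pi.add_apply, Pi.smul_apply, smul_eq_mul, smul_eq_mul]
  ring

theorem map_coordR_castSucc (g : Fin (N + 2) → ℂ) (j : Fin (N + 1)) :
    dualMap ((leftLin g).restrictScalars ℝ) (coordR j.castSucc) = coordR j.castSucc := by
  rw [← coframeR_castSucc j (nilMul g 0), dualMap_coframeR, coframeR_castSucc,
    coframeR_castSucc]

/-- The coefficients of the last form of the coframe. -/
def coframeCoeff (k : Fin (N + 2)) (y : Fin (N + 2) → ℂ) : ℂ :=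
  lastVec N k - coef N k * starRingEnd ℂ (y k)

/-- Over the constant frame the coefficients are real-affine functions of `y`, so
`extDeriv_sum_smul_extForm` gives the derivatives explicitly. -/
theorem coframeR_last_eq_sum (y : Fin (N + 2) → ℂ) :
    coframeR (Fin.last (N + 1)) y = ∑ k, coframeCoeff k y • coordR k := by
  ext v
  rw [coframeR_last_apply, cocycle_apply, sum_apply]
  have h : v (Fin.last (N + 1)) = ∑ k, lastVec N k * v k := by
    simp [Fin.sum_univ_castSucc]
  rw [h, ← Finset.sum_sub_distrib]
  refine Finset.sum_congr rfl fun k _ => ?_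
  rw [smul_apply, smul_eq_mul, coframeCoeff, sub_mul]
  rfl

theorem conjFun_coframeR_last_eq_sum (y : Fin (N + 2) → ℂ) :
    conjFun (coframeR (Fin.last (N + 1)) y) =
      ∑ k, starRingEnd ℂ (coframeCoeff k y) • conjFun (coordR k) := by
  rw [coframeR_last_eq_sum]
  ext v
  simp only [conjFun_apply, sum_apply, map_sum, smul_apply, smul_eq_mul, map_mul]

theorem hasFDerivAt_coframeCoeff (k : Fin (N + 2)) (y : Fin (N + 2) → ℂ) :
    HasFDerivAt (coframeCoeff k) (-(coef N k : ℂ) • conjFun (coordR k)) y := by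
  have h : HasFDerivAt (fun y => lastVec N k - (coef N k : ℂ) • conjFun (coordR k) y)
      (-((coef N k : ℂ) • conjFun (coordR k))) y :=
    (((coef N k : ℂ) • conjFun (coordR k)).hasFDerivAt).const_sub _
  exact h.congr_fderiv (neg_smul _ _).symm

theorem hasFDerivAt_conj_coframeCoeff (k : Fin (N + 2)) (y : Fin (N + 2) → ℂ) :
    HasFDerivAt (fun y => starRingEnd ℂ (coframeCoeff k y)) (-(coef N k : ℂ) • coordR k) y := by
  have h : HasFDerivAt (fun y => starRingEnd ℂ (lastVec N k) - (coef N k : ℂ) • coordR k y)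
      (-((coef N k : ℂ) • coordR k)) y :=
    (((coef N k : ℂ) • coordR k).hasFDerivAt).const_sub _
  refine (h.congr_fderiv (neg_smul _ _).symm).congr_of_eventuallyEq (Filter.Eventually.of_forall fun z => ?_)
  simp only [coframeCoeff, map_sub, map_mul, Complex.conj_ofReal, Complex.conj_conj, smul_eq_mul]
  rfl

theorem contDiff_coframeCoeff (k : Fin (N + 2)) : ContDiff ℝ ∞ (coframeCoeff k) := by
  have h : ContDiff ℝ ∞ (fun y => lastVec N k - (coef N k : ℂ) • conjFun (coordR k) y) :=
    contDiff_const.sub (((coef N k : ℂ) • conjFun (coordR k)).contDiff)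
  exact h

theorem contDiff_conj_coframeCoeff (k : Fin (N + 2)) :
    ContDiff ℝ ∞ (fun y => starRingEnd ℂ (coframeCoeff k y)) :=
  Complex.conjCLE.contDiff.comp (contDiff_coframeCoeff k)

theorem ι_coframeR_last (y : Fin (N + 2) → ℂ) :
    ι ℂ (coframeR (Fin.last (N + 1)) y) = ∑ k, coframeCoeff k y • ι ℂ (coordR k) := by
  rw [coframeR_last_eq_sum, map_sum]
  simp only [map_smul]

theorem ι_conjFun_coframeR_last (y : Fin (N + 2) → ℂ) :
    ι ℂ (conjFun (coframeR (Fin.last (N + 1)) y)) =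
      ∑ k, starRingEnd ℂ (coframeCoeff k y) • ι ℂ (conjFun (coordR k)) := by
  rw [conjFun_coframeR_last_eq_sum, map_sum]
  simp only [map_smul]

theorem pairing_coframeR_last (y : Fin (N + 2) → ℂ) :
    pairing (coframeR (Fin.last (N + 1)) y) =
      ∑ p : Fin (N + 2) × Fin (N + 2),
        (coframeCoeff p.1 y * starRingEnd ℂ (coframeCoeff p.2 y)) •
          (ι ℂ (coordR p.1) * ι ℂ (conjFun (coordR p.2))) := by
  rw [pairing, ι_coframeR_last, ι_conjFun_coframeR_last, Finset.sum_mul_sum,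
    ← Finset.univ_product_univ, Finset.sum_product]
  simp only [smul_mul_smul_comm]

/-- The exterior derivative of the last form of the coframe, in the exterior algebra. -/
def structElt (N : ℕ) : ExteriorAlgebra ℂ ((Fin (N + 2) → ℂ) →L[ℝ] ℂ) :=
  ∑ k, (coef N k : ℂ) • pairing (coordR k)

/-- Differentiating the coefficients gives `-∑ a_k dz̄_k ∧ dz_k`; swapping the factors removes the
sign. -/
theorem extDeriv_coframeR_last (y : Fin (N + 2) → ℂ) :
    extDeriv (fun y => extForm (Fin (N + 2) → ℂ) 1 (ι ℂ (coframeR (Fin.last (N + 1)) y))) y =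
      extForm (Fin (N + 2) → ℂ) 2 (structElt N) := by
  simp only [ι_coframeR_last, map_sum, map_smul]
  rw [extDeriv_sum_smul_extForm _ _ _ _ fun k _ =>
    (hasFDerivAt_coframeCoeff k y).differentiableAt, ← map_sum]
  congr 1
  refine Finset.sum_congr rfl fun k _ => ?_
  rw [(hasFDerivAt_coframeCoeff k y).fderiv, map_smul, pairing, ι_mul_ι_swap (coordR k),
    smul_mul_assoc, neg_smul, smul_neg]

/-- The sign arises because conjugation sends `dz_k ∧ dz̄_k` to its opposite and the `a_k` are real,
so `dω̄ = -Ω`. The constant factor `h`, being central, moves past the differential without a sign.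
-/
theorem extDeriv_mul_conj_coframeR_last {r : ℕ}
    {h : ExteriorAlgebra ℂ ((Fin (N + 2) → ℂ) →L[ℝ] ℂ)} (hh : ∀ z, z * h = h * z)
    (y : Fin (N + 2) → ℂ) :
    extDeriv (fun y => extForm (Fin (N + 2) → ℂ) r
      (h * ι ℂ (conjFun (coframeR (Fin.last (N + 1)) y)))) y =
      extForm (Fin (N + 2) → ℂ) (r + 1) (-(h * structElt N)) := by
  simp only [ι_conjFun_coframeR_last, Finset.mul_sum, mul_smul_comm, map_sum, map_smul]
  rw [extDeriv_sum_smul_extForm _ _ _ _ fun k _ =>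
    (hasFDerivAt_conj_coframeCoeff k y).differentiableAt, ← map_sum]
  congr 1
  rw [structElt, Finset.mul_sum, ← Finset.sum_neg_distrib]
  refine Finset.sum_congr rfl fun k _ => ?_
  rw [(hasFDerivAt_conj_coframeCoeff k y).fderiv, map_smul, pairing, smul_mul_assoc, ← mul_assoc,
    hh, mul_assoc, mul_smul_comm, neg_smul]

/-- The Leibniz rule `d(ω ∧ ω̄) = dω ∧ ω̄ - ω ∧ dω̄` with `dω̄ = -Ω`. -/
theorem extDeriv_mul_pairing_coframeR_last {r : ℕ}
    {h : ExteriorAlgebra ℂ ((Fin (N + 2) → ℂ) →L[ℝ] ℂ)} (hh : ∀ z, z * h = h * z)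
    (y : Fin (N + 2) → ℂ) :
    extDeriv (fun y => extForm (Fin (N + 2) → ℂ) r
      (h * pairing (coframeR (Fin.last (N + 1)) y))) y =
      extForm (Fin (N + 2) → ℂ) (r + 1)
        (h * (structElt N * ι ℂ (conjFun (coframeR (Fin.last (N + 1)) y)) +
          ι ℂ (coframeR (Fin.last (N + 1)) y) * structElt N)) := by
  have hd : ∀ p : Fin (N + 2) × Fin (N + 2), HasFDerivAt
      (fun y => coframeCoeff p.1 y * starRingEnd ℂ (coframeCoeff p.2 y))
      (coframeCoeff p.1 y • (-(coef N p.2 : ℂ) • coordR p.2) +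
        starRingEnd ℂ (coframeCoeff p.2 y) • (-(coef N p.1 : ℂ) • conjFun (coordR p.1))) y :=
    fun p => (hasFDerivAt_coframeCoeff p.1 y).mul (hasFDerivAt_conj_coframeCoeff p.2 y)
  simp only [pairing_coframeR_last, Finset.mul_sum, mul_smul_comm, map_sum, map_smul]
  rw [extDeriv_sum_smul_extForm _ _ _ _ fun p _ => (hd p).differentiableAt, ← map_sum]
  congr 1
  rw [structElt, ι_conjFun_coframeR_last, ι_coframeR_last, Finset.sum_mul_sum, Finset.sum_mul_sum,
    ← Finset.sum_add_distrib, Finset.mul_sum, ← Finset.univ_product_univ, Finset.sum_product]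
  refine Finset.sum_congr rfl fun k _ => ?_
  rw [← Finset.sum_add_distrib, Finset.mul_sum]
  refine Finset.sum_congr rfl fun l _ => ?_
  rw [(hd (k, l)).fderiv, ← mul_assoc, hh, mul_assoc]
  congr 1
  simp only [map_add, map_smul, add_mul, smul_mul_assoc, mul_smul_comm, smul_smul, pairing]
  rw [← mul_assoc (ι ℂ (coordR l)), ι_mul_ι_swap (coordR l) (coordR k),
    ← mul_assoc (ι ℂ (conjFun (coordR k))), ι_mul_ι_swap (conjFun (coordR k)) (coordR k)]
  refine (add_comm _ _).trans ?_
  simp only [neg_mul, smul_neg, mul_neg, neg_smul, neg_neg, mul_assoc]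
  congr 2
  ring

theorem contDiff_extForm_coframeR_last :
    ContDiff ℝ ∞ (fun y => extForm (Fin (N + 2) → ℂ) 1 (ι ℂ (coframeR (Fin.last (N + 1)) y))) := by
  simp only [ι_coframeR_last, map_sum, map_smul]
  refine ContDiff.sum fun k _ => ?_
  exact ((ContinuousLinearMap.id ℝ ℂ).smulRight
    (extForm (Fin (N + 2) → ℂ) 1 (ι ℂ (coordR k)))).contDiff.comp (contDiff_coframeCoeff k)

theorem contDiff_extForm_pairing_coframeR_last :
    ContDiff ℝ ∞ (fun y => extForm (Fin (N + 2) → ℂ) 2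
      (pairing (coframeR (Fin.last (N + 1)) y))) := by
  simp only [pairing_coframeR_last, map_sum, map_smul]
  refine ContDiff.sum fun p _ => ?_
  exact ((ContinuousLinearMap.id ℝ ℂ).smulRight (extForm (Fin (N + 2) → ℂ) 2
    (ι ℂ (coordR p.1) * ι ℂ (conjFun (coordR p.2))))).contDiff.comp
      ((contDiff_coframeCoeff p.1).mul (contDiff_conj_coframeCoeff p.2))

end InvariantForms

/-! ### The metrics -/

section Metrics

open ExteriorAlgebra

variable {N : ℕ}

/-- The sum of the elements `dz_j ∧ dz̄_j` for the first `N` coordinates. -/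
def sumPairing (N : ℕ) : ExtCenter (Fin (N + 2) → ℂ) :=
  ∑ j : Fin N, centerPairing (coordR j.castSucc.castSucc)

/-- The element `dz_j ∧ dz̄_j` for the last coordinate but one. -/
def midPairing (N : ℕ) : ExtCenter (Fin (N + 2) → ℂ) :=
  centerPairing (coordR (Fin.last N).castSucc)

/-- The horizontal part of the metrics. -/
def baseElt (N : ℕ) (c : ℂ) : ExtCenter (Fin (N + 2) → ℂ) := sumPairing N + c • midPairing N

theorem sumPairing_pow : sumPairing N ^ (N + 1) = 0 := by
  have := sum_pow_card_succ_eq_zero Finset.univ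
    (fun j : Fin N => centerPairing (coordR (N := N) j.castSucc.castSucc))
    fun j _ => centerPairing_sq _
  rwa [Finset.card_univ, Fintype.card_fin] at this

theorem midPairing_sq : midPairing N ^ 2 = 0 := centerPairing_sq _

theorem extIncl_baseElt (c : ℂ) : extIncl (baseElt N c) =
    ∑ j : Fin N, pairing (coordR j.castSucc.castSucc) +
      c • pairing (coordR (Fin.last N).castSucc) := by
  rw [baseElt, sumPairing, midPairing, map_add, map_smul, map_sum]
  rfl

/-- Thus `Ω` belongs to the same two-parameter family, generated by `S` and `T`, as the horizontal
parts of the metrics. -/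
theorem structElt_eq : structElt N = extIncl (baseElt N (-(N : ℂ))) := by
  rw [extIncl_baseElt, structElt, Fin.sum_univ_castSucc, Fin.sum_univ_castSucc, coef_last]
  simp [coef, coefInt]

/-- The element of the exterior algebra giving the metric with parameter `c`, up to the
factor `i / 2`. -/
def metricElt (c : ℂ) (y : Fin (N + 2) → ℂ) : ExtCenter (Fin (N + 2) → ℂ) :=
  baseElt N c + centerPairing (coframeR (Fin.last (N + 1)) y)

theorem extIncl_baseElt_mem (c : ℂ) :
    extIncl (baseElt N c) ∈ ⋀[ℂ]^2 ((Fin (N + 2) → ℂ) →L[ℝ] ℂ) := by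
  rw [extIncl_baseElt]
  exact add_mem (sum_mem fun j _ => pairing_mem _) (Submodule.smul_mem _ _ (pairing_mem _))

theorem extIncl_metricElt (c : ℂ) (y : Fin (N + 2) → ℂ) :
    extIncl (metricElt c y) =
      extIncl (baseElt N c) + pairing (coframeR (Fin.last (N + 1)) y) := rfl

theorem smul_extIncl_metricElt_mem (b c : ℂ) (y : Fin (N + 2) → ℂ) :
    b • extIncl (metricElt c y) ∈ ⋀[ℂ]^2 ((Fin (N + 2) → ℂ) →L[ℝ] ℂ) := by
  rw [extIncl_metricElt]
  exact Submodule.smul_mem _ _ (add_mem (extIncl_baseElt_mem c) (pairing_mem _))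

theorem map_baseElt (g : Fin (N + 2) → ℂ) (c : ℂ) :
    map (dualMap ((leftLin g).restrictScalars ℝ)) (extIncl (baseElt N c)) =
      extIncl (baseElt N c) := by
  simp only [extIncl_baseElt, map_add, map_sum, map_smul, map_pairing, map_coordR_castSucc]

theorem map_metricElt (g y : Fin (N + 2) → ℂ) (c : ℂ) :
    map (dualMap ((leftLin g).restrictScalars ℝ)) (extIncl (metricElt c (nilMul g y))) =
      extIncl (metricElt c y) := by
  rw [extIncl_metricElt, map_add, map_baseElt, map_pairing, dualMap_coframeR, extIncl_metricElt]

theorem extRot_baseElt (b c : ℂ) :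
    extRot _ b (extIncl (baseElt N c)) = (b * starRingEnd ℂ b) • extIncl (baseElt N c) := by
  simp only [extIncl_baseElt, map_add, map_sum, map_smul, coordR, extRot_pairing, smul_add,
    Finset.smul_sum]
  rw [smul_comm c]

theorem extRot_metricElt (b c : ℂ) (y : Fin (N + 2) → ℂ) :
    extRot _ b (extIncl (metricElt c y)) = (b * starRingEnd ℂ b) • extIncl (metricElt c y) := by
  rw [extIncl_metricElt, map_add, extRot_baseElt, coframeR, extRot_pairing, smul_add]

/-- The power of order `k` of the metric with parameter `c`, on the group. -/
def metricPow (c : ℂ) (k : ℕ) : DiffForm (Fin (N + 2) → ℂ) (Fin (N + 2) → ℂ) (2 * k) := fun y =>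
  extForm _ (2 * k) ((Complex.I / 2) ^ k • extIncl (metricElt c y) ^ k)

/-- The metric with parameter `c` on the group. -/
def metricForm (c : ℂ) : DiffForm (Fin (N + 2) → ℂ) (Fin (N + 2) → ℂ) 2 := fun y =>
  extForm _ 2 ((Complex.I / 2) • extIncl (metricElt c y))

theorem wedgePow_metricForm (c : ℂ) (k : ℕ) (y : Fin (N + 2) → ℂ) :
    wedgePow (metricForm c y) k = metricPow c k y := by
  rw [metricForm, (wedgePow_extForm (smul_extIncl_metricElt_mem _ c y) k).2, metricPow, smul_pow]

theorem formPow_metricForm (c : ℂ) (k : ℕ) :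
    formPow (descend (metricForm (N := N) c)) k = descend (metricPow c k) := by
  funext x
  exact wedgePow_metricForm c k (nilRep x)

theorem isLeftInvariantBy_metricPow (c : ℂ) (k : ℕ) (g : Fin (N + 2) → ℂ) :
    IsLeftInvariantBy g (metricPow c k) := by
  intro y
  rw [metricPow, extForm_comp, map_smul, map_pow, map_metricElt, metricPow]

theorem isLeftInvariantBy_metricForm (c : ℂ) (g : Fin (N + 2) → ℂ) :
    IsLeftInvariantBy g (metricForm c) := by
  intro y
  rw [metricForm, extForm_comp, map_smul, map_metricElt, metricForm]

theorem hasType_metricPow (c : ℂ) (k : ℕ) (y : Fin (N + 2) → ℂ) :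
    HasType k k (metricPow c k y) := by
  refine hasType_extForm (by ring) fun b => ?_
  rw [map_smul, map_pow, extRot_metricElt, smul_pow, smul_comm, mul_pow]

theorem hasType_metricForm (c : ℂ) (y : Fin (N + 2) → ℂ) : HasType 1 1 (metricForm c y) := by
  refine hasType_extForm rfl fun b => ?_
  rw [map_smul, extRot_metricElt, smul_comm, pow_one, pow_one]

theorem extForm_pairing (φ : (Fin (N + 2) → ℂ) →L[ℝ] ℂ) (v : Fin 2 → (Fin (N + 2) → ℂ)) :
    extForm _ 2 (pairing φ) v =
      φ (v 0) * starRingEnd ℂ (φ (v 1)) - φ (v 1) * starRingEnd ℂ (φ (v 0)) :=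
  extForm_ι_mul_ι φ (conjFun φ) v

theorem metricForm_apply (c : ℂ) (y : Fin (N + 2) → ℂ) (v : Fin 2 → (Fin (N + 2) → ℂ)) :
    metricForm c y v = (Complex.I / 2) *
      (∑ j : Fin N, extForm _ 2 (pairing (coordR j.castSucc.castSucc)) v +
        c * extForm _ 2 (pairing (coordR (Fin.last N).castSucc)) v +
        extForm _ 2 (pairing (coframeR (Fin.last (N + 1)) y)) v) := by
  rw [metricForm, extIncl_metricElt, extIncl_baseElt, map_smul, map_add, map_add, map_sum, map_smul]
  simp only [ContinuousAlternatingMap.smul_apply, ContinuousAlternatingMap.add_apply,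
    ContinuousAlternatingMap.sum_apply, smul_eq_mul]

theorem contDiff_metricForm (c : ℂ) : ContDiff ℝ ∞ (metricForm (N := N) c) := by
  have h : metricForm (N := N) c = fun y => extForm _ 2 ((Complex.I / 2) •
      extIncl (baseElt N c)) + (Complex.I / 2) •
      extForm _ 2 (pairing (coframeR (Fin.last (N + 1)) y)) := by
    funext y
    rw [metricForm, extIncl_metricElt, smul_add, map_add, map_smul _ _ (pairing _)]
  rw [h]
  exact contDiff_const.add (contDiff_extForm_pairing_coframeR_last.const_smul _)

theorem extForm_pairing_I_smul (φ : (Fin (N + 2) → ℂ) →L[ℂ] ℂ) (v : Fin (N + 2) → ℂ) :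
    (Complex.I / 2) * extForm _ 2 (pairing (φ.restrictScalars ℝ)) ![v, Complex.I • v] =
      (Complex.normSq (φ v) : ℂ) := by
  rw [extForm_pairing]
  change (Complex.I / 2) * (φ v * starRingEnd ℂ (φ (Complex.I • v)) -
    φ (Complex.I • v) * starRingEnd ℂ (φ v)) = _
  rw [map_smul, smul_eq_mul, map_mul, Complex.conj_I, Complex.normSq_eq_conj_mul_self]
  linear_combination (-φ v * starRingEnd ℂ (φ v)) * Complex.I_sq

theorem metricForm_pos {c : ℝ} (hc : 0 < c) (y v : Fin (N + 2) → ℂ) (hv : v ≠ 0) :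
    0 < (metricForm (c : ℂ) y ![v, Complex.I • v]).re := by
  have h : metricForm (c : ℂ) y ![v, Complex.I • v] =
      ((∑ j : Fin N, Complex.normSq (v j.castSucc.castSucc) +
        c * Complex.normSq (v (Fin.last N).castSucc) +
        Complex.normSq (coframe (Fin.last (N + 1)) y v) : ℝ) : ℂ) := by
    rw [metricForm_apply, mul_add, mul_add, Finset.mul_sum, mul_left_comm, coframeR,
      extForm_pairing_I_smul]
    simp only [coordR, extForm_pairing_I_smul]
    push_cast
    rfl
  rw [h, Complex.ofReal_re]
  have h1 : 0 ≤ ∑ j : Fin N, Complex.normSq (v j.castSucc.castSucc) :=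
    Finset.sum_nonneg fun j _ => Complex.normSq_nonneg _
  have h2 : 0 ≤ c * Complex.normSq (v (Fin.last N).castSucc) :=
    mul_nonneg hc.le (Complex.normSq_nonneg _)
  have h3 : 0 ≤ Complex.normSq (coframe (Fin.last (N + 1)) y v) := Complex.normSq_nonneg _
  by_contra hle
  have e1 : ∑ j : Fin N, Complex.normSq (v j.castSucc.castSucc) = 0 := by linarith
  have e2 : c * Complex.normSq (v (Fin.last N).castSucc) = 0 := by linarith
  have e3 : Complex.normSq (coframe (Fin.last (N + 1)) y v) = 0 := by linarith
  rw [Finset.sum_eq_zero_iff_of_nonneg fun j _ => Complex.normSq_nonneg _] at e1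
  have hz : ∀ j : Fin (N + 1), v j.castSucc = 0 := by
    intro j
    induction j using Fin.lastCases with
    | last => exact Complex.normSq_eq_zero.1 ((mul_eq_zero.1 e2).resolve_left hc.ne')
    | cast j => exact Complex.normSq_eq_zero.1 (e1 j (Finset.mem_univ _))
  have hl : v (Fin.last (N + 1)) = 0 := by
    have h4 : coframeR (Fin.last (N + 1)) y v = 0 := Complex.normSq_eq_zero.1 e3
    rw [coframeR_last_apply, cocycle_apply, Fin.sum_univ_castSucc, coef_last] at h4
    simpa [hz] using h4
  apply hv
  funext j
  induction j using Fin.lastCases with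
  | last => exact hl
  | cast j => exact hz j

theorem isHermitianMetric_metricForm {c : ℝ} (hc : 0 < c) :
    IsHermitianMetric (descend (metricForm (N := N) (c : ℂ))) where
  smooth := isSmoothForm_descend (fun γ _ => isLeftInvariantBy_metricForm _ γ)
    (contDiff_metricForm _)
  real := by
    funext x
    ext v
    change starRingEnd ℂ (metricForm (c : ℂ) (nilRep x) v) = metricForm (c : ℂ) (nilRep x) v
    rw [metricForm_apply]
    simp only [extForm_pairing, map_mul, map_add, map_sum, map_sub, map_div₀, Complex.conj_I,
      Complex.conj_conj, Complex.conj_ofReal, map_ofNat]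
    -- Conjugation reverses the sign of `i / 2` and of each `φ ∧ φ̄`.
    rw [neg_div, neg_mul, ← mul_neg, neg_add, neg_add, ← Finset.sum_neg_distrib, ← mul_neg]
    simp only [neg_sub]
    congr 2
    · congr 1
      · refine Finset.sum_congr rfl fun j _ => ?_
        ring
      · ring
    · ring
  type x := hasType_metricForm _ _
  pos x v hv := metricForm_pos hc _ v hv

/-- The coefficient of the exterior derivative of the powers of the metrics. -/
def derivElt (N : ℕ) (c : ℂ) (k : ℕ) : ExtCenter (Fin (N + 2) → ℂ) :=
  ((Complex.I / 2) ^ (k + 1) * (k + 1 : ℕ)) • (baseElt N c ^ k * baseElt N (-(N : ℂ)))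

theorem map_derivElt (g : Fin (N + 2) → ℂ) (c : ℂ) (k : ℕ) :
    map (dualMap ((leftLin g).restrictScalars ℝ)) (extIncl (derivElt N c k)) =
      extIncl (derivElt N c k) := by
  simp only [derivElt, map_smul, map_mul, map_pow, map_baseElt]

theorem extRot_derivElt (b c : ℂ) (k : ℕ) :
    extRot _ b (extIncl (derivElt N c k)) =
      (b * starRingEnd ℂ b) ^ (k + 1) • extIncl (derivElt N c k) := by
  simp only [derivElt, map_smul, map_mul, map_pow, extRot_baseElt]
  rw [smul_pow, smul_mul_smul_comm, ← pow_succ, smul_comm]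

/-- The `∂̄` part of the exterior derivative of the powers of the metrics. -/
def delbarMetricPow (c : ℂ) (k : ℕ) :
    DiffForm (Fin (N + 2) → ℂ) (Fin (N + 2) → ℂ) (2 * (k + 1) + 1) := fun y =>
  extForm _ (2 * (k + 1) + 1) (extIncl (derivElt N c k) *
    ι ℂ (conjFun (coframeR (Fin.last (N + 1)) y)))

/-- The `∂` part of the exterior derivative of the powers of the metrics. -/
def delMetricPow (c : ℂ) (k : ℕ) :
    DiffForm (Fin (N + 2) → ℂ) (Fin (N + 2) → ℂ) (2 * (k + 1) + 1) := fun y =>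
  extForm _ (2 * (k + 1) + 1) (extIncl (derivElt N c k) * ι ℂ (coframeR (Fin.last (N + 1)) y))

theorem extDeriv_const_add {E F : Type*} [NormedAddCommGroup E] [NormedSpace ℝ E]
    [NormedAddCommGroup F] [NormedSpace ℝ F] {r : ℕ} (a : E [⋀^Fin r]→L[ℝ] F)
    (α : E → E [⋀^Fin r]→L[ℝ] F) (y : E) :
    extDeriv (fun y => a + α y) y = extDeriv α y := by
  rw [extDeriv, extDeriv, fderiv_const_add]

/-- Since `ω ∧ ω̄` has square zero, the power splits into a part with constant coefficients, hence
closed, and a constant multiple of `B^k ω ∧ ω̄`. -/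
theorem metricElt_pow_succ (c : ℂ) (k : ℕ) (y : Fin (N + 2) → ℂ) :
    (Complex.I / 2) ^ (k + 1) • extIncl (metricElt c y) ^ (k + 1) =
      (Complex.I / 2) ^ (k + 1) • extIncl (baseElt N c) ^ (k + 1) +
      extIncl (((Complex.I / 2) ^ (k + 1) * (k + 1 : ℕ)) • baseElt N c ^ k) *
        pairing (coframeR (Fin.last (N + 1)) y) := by
  rw [← map_pow, metricElt, add_pow_succ_of_sq_eq_zero (centerPairing_sq _),
    ← extIncl_centerPairing, map_add, smul_add, map_pow, ← map_mul, ← map_smul]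
  congr 2
  rw [smul_mul_assoc, mul_smul, Nat.cast_smul_eq_nsmul, nsmul_eq_mul]

theorem extDeriv_metricPow (c : ℂ) (k : ℕ) (y : Fin (N + 2) → ℂ) :
    extDeriv (metricPow (N := N) c (k + 1)) y = delbarMetricPow c k y + delMetricPow c k y := by
  have h : metricPow (N := N) c (k + 1) = fun y =>
      extForm _ (2 * (k + 1)) ((Complex.I / 2) ^ (k + 1) • extIncl (baseElt N c) ^ (k + 1)) +
      extForm _ (2 * (k + 1)) (extIncl (((Complex.I / 2) ^ (k + 1) * (k + 1 : ℕ)) •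
        baseElt N c ^ k) * pairing (coframeR (Fin.last (N + 1)) y)) := by
    funext y
    rw [metricPow, metricElt_pow_succ, map_add]
  rw [h, extDeriv_const_add]
  refine (extDeriv_mul_pairing_coframeR_last (r := 2 * (k + 1)) (mul_extIncl_comm
    (((Complex.I / 2) ^ (k + 1) * (k + 1 : ℕ)) • baseElt N c ^ k)) y).trans ?_
  rw [delbarMetricPow, delMetricPow]
  refine Eq.trans ?_ (map_add (extForm (Fin (N + 2) → ℂ) (2 * (k + 1) + 1)) _ _)
  congr 1
  rw [structElt_eq, mul_extIncl_comm (baseElt N (-(N : ℂ))), ← mul_add, ← mul_add, ← mul_assoc,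
    derivElt, ← map_mul, smul_mul_assoc]

theorem hasType_delbarMetricPow (c : ℂ) (k : ℕ) (y : Fin (N + 2) → ℂ) :
    HasType (k + 1) (k + 2) (delbarMetricPow c k y) := by
  refine hasType_extForm (by ring) fun b => ?_
  rw [map_mul, extRot_derivElt, coframeR, extRot_ι_conjFun, smul_mul_smul_comm]
  congr 1
  ring

theorem hasType_delMetricPow (c : ℂ) (k : ℕ) (y : Fin (N + 2) → ℂ) :
    HasType (k + 2) (k + 1) (delMetricPow c k y) := by
  refine hasType_extForm (by ring) fun b => ?_
  rw [map_mul, extRot_derivElt, coframeR, extRot_ι, smul_mul_smul_comm]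
  congr 1
  ring

/-! ### Derivatives of the powers of the metrics on the nilmanifold -/

theorem extd_formPow (c : ℂ) (k : ℕ) :
    extd (formPow (descend (metricForm (N := N) c)) (k + 1)) =
      descend fun y => delbarMetricPow c k y + delMetricPow c k y := by
  rw [formPow_metricForm, extd_descend fun γ _ => isLeftInvariantBy_metricPow _ _ γ]
  funext x
  exact extDeriv_metricPow c k _

theorem delbar_formPow (c : ℂ) (k : ℕ) :
    delbar (formPow (descend (metricForm (N := N) c)) (k + 1)) =
      descend (delbarMetricPow c k) := by
  funext x
  rw [delbar_of_hasType (p := k + 1) (q := k + 1), extd_formPow]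
  · change typePart (k + 1) (delbarMetricPow c k _ + delMetricPow c k _) = _
    rw [typePart_add, typePart_of_hasType (hasType_delbarMetricPow c k _),
      typePart_of_hasType_ne (hasType_delMetricPow c k _) (by omega) (by omega), add_zero]
    rfl
  · intro x
    rw [formPow_metricForm]
    exact hasType_metricPow c (k + 1) _

theorem isLeftInvariantBy_delbarMetricPow (c : ℂ) (k : ℕ) (g : Fin (N + 2) → ℂ) :
    IsLeftInvariantBy g (delbarMetricPow c k) := by
  intro y
  rw [delbarMetricPow, extForm_comp, map_mul (map _), map_apply_ι, dualMap_conjFun,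
    dualMap_coframeR, map_derivElt, delbarMetricPow]

/-- The form `∂∂̄` of the powers of the metrics, in the exterior algebra. -/
def delDelbarElt (N : ℕ) (c : ℂ) (k : ℕ) : ExtCenter (Fin (N + 2) → ℂ) :=
  -((Complex.I / 2) ^ (k + 1) * (k + 1 : ℕ)) •
    (baseElt N c ^ k * baseElt N (-(N : ℂ)) ^ 2)

theorem extDeriv_delbarMetricPow (c : ℂ) (k : ℕ) (y : Fin (N + 2) → ℂ) :
    extDeriv (delbarMetricPow (N := N) c k) y =
      extForm _ (2 * (k + 1) + 1 + 1) (extIncl (delDelbarElt N c k)) := by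
  have h0 : delbarMetricPow (N := N) c k = fun y => extForm _ (2 * (k + 1) + 1)
    (extIncl (derivElt N c k) * ι ℂ (conjFun (coframeR (Fin.last (N + 1)) y))) := rfl
  rw [h0, extDeriv_mul_conj_coframeR_last (mul_extIncl_comm _), structElt_eq, ← map_mul,
    ← map_neg]
  congr 2
  rw [delDelbarElt, derivElt, smul_mul_assoc, sq, mul_assoc]
  exact (neg_smul _ _).symm

theorem hasType_extForm_delDelbarElt (c : ℂ) (k : ℕ) :
    HasType (k + 2) (k + 2)
      (extForm _ (2 * (k + 1) + 1 + 1) (extIncl (delDelbarElt N c k))) := by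
  refine hasType_extForm (by ring) fun b => ?_
  simp only [delDelbarElt, map_smul, map_mul, map_pow, extRot_baseElt]
  rw [smul_pow, smul_pow, smul_mul_smul_comm, smul_comm]
  congr 1
  ring

/-- The differential of the `∂̄` part replaces `ω̄` by `-Ω`. The result is already of type `(k + 2,
k + 2)`, so the type projection changes nothing. -/
theorem del_delbar_formPow (c : ℂ) (k : ℕ) (x : Nilmanifold N) :
    del (delbar (formPow (descend (metricForm (N := N) c)) (k + 1))) x =
      extForm _ (2 * (k + 1) + 1 + 1) (extIncl (delDelbarElt N c k)) := by
  have ht : ∀ x : Nilmanifold N,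
      HasType (k + 1) (k + 2) (descend (delbarMetricPow (N := N) c k) x) :=
    fun x => hasType_delbarMetricPow c k _
  rw [delbar_formPow, del_of_hasType ht,
    extd_descend fun γ _ => isLeftInvariantBy_delbarMetricPow c k γ]
  change typePart (k + 1 + 1) (extDeriv (delbarMetricPow (N := N) c k) (nilRep x)) = _
  rw [extDeriv_delbarMetricPow]
  exact typePart_of_hasType (hasType_extForm_delDelbarElt c k)

theorem baseElt_neg : baseElt N (-(N : ℂ)) = sumPairing N - (N : ℕ) * midPairing N := by
  rw [baseElt, neg_smul, Nat.cast_smul_eq_nsmul, nsmul_eq_mul, sub_eq_add_neg]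

theorem isBalanced_metricForm (hN : N ≠ 0) :
    IsBalanced (N + 2) (descend (metricForm (N := N) ((1 : ℝ) : ℂ))) := by
  refine ⟨isHermitianMetric_metricForm one_pos, ?_⟩
  obtain ⟨M, rfl⟩ := Nat.exists_eq_succ_of_ne_zero hN
  -- Here `n - 1 = N + 1`, so the factor to annihilate is `B^N Ω` with `N = M + 1`.
  have h : derivElt (M + 1) ((1 : ℝ) : ℂ) (M + 1) = 0 := by
    rw [derivElt, baseElt_neg, baseElt, Complex.ofReal_one, one_smul,
      balanced_identity sumPairing_pow midPairing_sq, smul_zero]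
  have h2 := extd_formPow (N := M + 1) ((1 : ℝ) : ℂ) (M + 1)
  refine h2.trans ?_
  funext x
  simp only [descend, delbarMetricPow, delMetricPow, h, map_zero extIncl, zero_mul, map_zero,
    add_zero]
  rfl

/-- The parameter of the astheno-Kähler metric. -/
def asthenoParam (N : ℕ) : ℝ := 2 * N / (N - 1)

theorem asthenoParam_pos (hN : 2 ≤ N) : 0 < asthenoParam N := by
  have : (2 : ℝ) ≤ N := by exact_mod_cast hN
  unfold asthenoParam
  apply div_pos <;> linarith

theorem baseElt_asthenoParam {M : ℕ} :
    baseElt (M + 2) (asthenoParam (M + 2) : ℂ) ^ (M + 1) *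
      baseElt (M + 2) (-((M + 2 : ℕ) : ℂ)) ^ 2 = 0 := by
  have hM : (M : ℝ) + 1 ≠ 0 := by positivity
  have hc : asthenoParam (M + 2) * (M + 1 : ℕ) = 2 * (M + 2 : ℕ) := by
    unfold asthenoParam
    push_cast
    have : (M : ℝ) + 2 - 1 ≠ 0 := by intro h; apply hM; linarith
    field_simp
    ring
  have hc' : (asthenoParam (M + 2) : ℂ) * (M + 1 : ℕ) = 2 * (M + 2 : ℕ) := by exact_mod_cast hc
  rw [baseElt_neg, baseElt, Algebra.smul_def]
  refine asthenoKahler_identity sumPairing_pow midPairing_sq ?_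
  have := congrArg (algebraMap ℂ (ExtCenter (Fin (M + 2 + 2) → ℂ))) hc'
  simpa only [map_mul, map_natCast, map_ofNat] using this

theorem isAsthenoKahler_metricForm (hN : 2 ≤ N) :
    IsAsthenoKahler (N + 2) (descend (metricForm (N := N) (asthenoParam N : ℂ))) := by
  refine ⟨isHermitianMetric_metricForm (asthenoParam_pos hN), ?_⟩
  obtain ⟨M, rfl⟩ := Nat.exists_eq_add_of_le' hN
  funext x
  -- Here `n - 2 = N = M + 2`, so the relevant factor is `B^(M+1) Ω²`.
  refine (del_delbar_formPow (N := M + 2) _ (M + 1) x).trans ?_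
  rw [delDelbarElt, baseElt_asthenoParam, smul_zero, map_zero, map_zero]
  rfl

theorem extIncl_delDelbarElt_mem (c : ℂ) (k : ℕ) :
    extIncl (delDelbarElt N c k) ∈ ⋀[ℂ]^(2 * (k + 1) + 1 + 1) ((Fin (N + 2) → ℂ) →L[ℝ] ℂ) := by
  rw [delDelbarElt, map_smul, map_mul, map_pow, map_pow,
    show 2 * (k + 1) + 1 + 1 = 2 * k + 2 * 2 by ring]
  exact Submodule.smul_mem _ _ (SetLike.mul_mem_graded
    (A := fun i => ⋀[ℂ]^i ((Fin (N + 2) → ℂ) →L[ℝ] ℂ))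
    (wedgePow_extForm (extIncl_baseElt_mem c) k).1 (wedgePow_extForm (extIncl_baseElt_mem _) 2).1)

theorem isGauduchon_metricForm (hN : 2 ≤ N) {k : ℕ} (hk : 1 ≤ k) (hkN : k ≤ N + 1) :
    IsGauduchon (N + 2) k (descend (metricForm (N := N) (asthenoParam N : ℂ))) := by
  refine ⟨isHermitianMetric_metricForm (asthenoParam_pos hN), fun x => ?_⟩
  obtain ⟨M, rfl⟩ := Nat.exists_eq_add_of_le' hN
  obtain ⟨k, rfl⟩ := Nat.exists_eq_add_of_le' hk
  rw [del_delbar_formPow, formPow_metricForm]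
  change wedge _ (metricPow _ _ (nilRep x)) = 0
  rw [← wedgePow_metricForm, metricForm]
  have hf := wedgePow_extForm (smul_extIncl_metricElt_mem (N := M + 2) (Complex.I / 2)
    (asthenoParam (M + 2)) (nilRep x)) (M + 2 + 2 - (k + 1) - 1)
  -- The exponents add up to `M + 2`, exactly one more than the power of `B` that kills `Ω²`.
  have hz := mul_add_pow_eq_zero (k := k) (l := M + 2 + 2 - (k + 1) - 1)
    (centerPairing_sq (coframeR (Fin.last (M + 2 + 1)) (nilRep x)))
    (baseElt_asthenoParam (M := M)) (by omega)
  rw [hf.2, wedge_extForm (extIncl_delDelbarElt_mem _ k) hf.1, smul_pow, mul_smul_comm,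
    ← map_pow, ← map_mul, delDelbarElt, smul_mul_assoc, metricElt, hz, smul_zero, map_zero,
    smul_zero, map_zero]

/-- The invariant coframe on the nilmanifold. -/
def nilCoframe (j : Fin (N + 2)) : DiffForm (Fin (N + 2) → ℂ) (Nilmanifold N) 1 :=
  descend fun y => extForm _ 1 (ι ℂ (coframeR j y))

theorem isLeftInvariantBy_coframe (g : Fin (N + 2) → ℂ) (j : Fin (N + 2)) :
    IsLeftInvariantBy g (fun y => extForm _ 1 (ι ℂ (coframeR j y))) := by
  intro y
  simp only [extForm_comp, map_apply_ι, dualMap_coframeR]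

theorem isInvariantCoframe_nilCoframe :
    IsInvariantCoframe (G := NilGroup N) (nilProj (N := N)) nilCoframe where
  smooth j := by
    refine isSmoothForm_descend (fun γ _ => isLeftInvariantBy_coframe γ j) ?_
    induction j using Fin.lastCases with
    | last => exact contDiff_extForm_coframeR_last
    | cast j => simp only [coframeR_castSucc]; exact contDiff_const
  type j x := by
    refine hasType_extForm rfl fun b => ?_
    rw [coframeR, extRot_ι, pow_one, pow_zero, mul_one]
  frame x := by
    have hval : ∀ (j : Fin (N + 2)) (v : Fin 1 → (Fin (N + 2) → ℂ)),
        nilCoframe j x v = coframeR j (nilRep x) (v 0) := fun j v => extForm_ι _ v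
    rw [Fintype.linearIndependent_iff]
    intro b hb j
    have h : ∀ v : Fin (N + 2) → ℂ, ∑ j, b j * coframeR j (nilRep x) v = 0 := by
      intro v
      have := congrArg (fun α : (Fin (N + 2) → ℂ) [⋀^Fin 1]→L[ℝ] ℂ => α fun _ => v) hb
      simpa [ContinuousAlternatingMap.sum_apply, hval] using this
    -- The translated basis vectors form the dual frame, so evaluating the relation on them isolates
    -- each coefficient.
    have h2 := h (leftLin (nilRep x) (Pi.single j 1))
    have h3 : ∀ i, coframeR i (nilRep x) (leftLin (nilRep x) (Pi.single j 1)) =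
        (Pi.single j 1 : Fin (N + 2) → ℂ) i := by
      intro i
      rw [coframeR_apply, leftLin_apply, map_add, map_smul, cocycle_lastVec]
      simp
    simpa [h3, Pi.single_apply] using h2
  leftInvariant g j := by
    have h : pullback (nilProj (N := N)) (nilCoframe j) =
        fun y => extForm _ 1 (ι ℂ (coframeR j y)) :=
      pullback_nilProj_descend fun γ _ => isLeftInvariantBy_coframe γ j
    change pullback (nilMul g) (pullback (nilProj (N := N)) (nilCoframe j)) =
      pullback (nilProj (N := N)) (nilCoframe j)
    rw [h]
    funext y
    exact (pullback_nilMul (N := N) g _ y).trans (isLeftInvariantBy_coframe g j y)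

theorem structureEquations_nilCoframe :
    StructureEquations (nilCoframe (N := N)) (coef N) := by
  intro l x
  have hextd : extd (nilCoframe l) x = extDeriv (fun y => extForm _ 1 (ι ℂ (coframeR l y)))
      (nilRep x) := by
    rw [nilCoframe, extd_descend fun γ _ => isLeftInvariantBy_coframe γ l]
    rfl
  rw [hextd]
  have hconj : ∀ j, conjForm (nilCoframe j) x =
      extForm _ 1 (ι ℂ (conjFun (coframeR j (nilRep x)))) := by
    intro j
    ext v
    change starRingEnd ℂ (extForm _ 1 (ι ℂ (coframeR j (nilRep x))) v) = _
    rw [extForm_ι, extForm_ι, conjFun_apply]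
  have hw : ∀ j, wedge (nilCoframe j x) (conjForm (nilCoframe j) x) =
      extForm _ 2 (pairing (coframeR j (nilRep x))) := by
    intro j
    rw [hconj]
    exact wedge_extForm (ι_mem _) (ι_mem _)
  induction l using Fin.lastCases with
  | last =>
    rw [if_pos (by simp), extDeriv_coframeR_last]
    simp only [hw]
    have hsub : ∑ j ∈ Finset.univ.filter (fun j : Fin (N + 2) => (j : ℕ) + 1 < N + 2),
        (coef N j : ℂ) • extForm _ 2 (pairing (coframeR j (nilRep x))) =
        ∑ j, (coef N j : ℂ) • extForm _ 2 (pairing (coframeR j (nilRep x))) := by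
      refine Finset.sum_subset (Finset.filter_subset _ _) fun j _ hj => ?_
      have : j = Fin.last (N + 1) := by
        ext; simp at hj; simp; omega
      rw [this, coef_last, Complex.ofReal_zero]
      ext v
      exact zero_mul _
    rw [hsub, structElt, map_sum]
    refine Finset.sum_congr rfl fun j _ => ?_
    rw [map_smul]
    induction j using Fin.lastCases with
    | last => rw [coef_last, Complex.ofReal_zero]; ext v; exact (zero_mul _).trans (zero_mul _).symm
    | cast j => rw [coframeR_castSucc]
  | cast j =>
    have hj : ((j.castSucc : Fin (N + 2)) : ℕ) + 1 ≠ N + 2 := by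
      simp only [Fin.val_castSucc]; omega
    rw [if_neg hj]
    simp only [coframeR_castSucc]
    rw [extDeriv, fderiv_fun_const]
    exact (ContinuousAlternatingMap.alternatizeUncurryFinCLM ℝ _ ℂ).map_zero

end Metrics

/-! ### Averages along segments -/

section Average

variable {E F G : Type*} [NormedAddCommGroup E] [NormedSpace ℝ E]
  [NormedAddCommGroup F] [NormedSpace ℝ F] [NormedAddCommGroup G] [NormedSpace ℝ G]

/-- The average of `β` over the segment from `y` to `y + u`. -/
def segmentAverage (u : E) (β : E → F) (y : E) : F := ∫ s in (0 : ℝ)..1, β (y + s • u)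

theorem continuous_segmentAverage {u : E} {β : E → F} (hβ : Continuous β) :
    Continuous (segmentAverage u β) :=
  intervalIntegral.continuous_parametric_intervalIntegral_of_continuous'
    (f := fun y s => β (y + s • u)) (by
      change Continuous fun p : E × ℝ => β (p.1 + p.2 • u)
      fun_prop) 0 1

/-- Differentiation under the integral sign; the derivative is bounded on a compact neighbourhood of
the segment. -/
theorem hasFDerivAt_segmentAverage [ProperSpace E] {u : E} {β : E → F} (hβ : ContDiff ℝ 1 β)
    (y : E) : HasFDerivAt (segmentAverage u β) (segmentAverage u (fderiv ℝ β) y) y := by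
  have hc : Continuous (fderiv ℝ β) := hβ.continuous_fderiv one_ne_zero
  have hb := hβ.continuous
  have hK : IsCompact (Metric.closedBall y 1 ×ˢ Set.Icc (0 : ℝ) 1) :=
    (isCompact_closedBall y 1).prod isCompact_Icc
  obtain ⟨C, hC⟩ := hK.exists_bound_of_continuousOn
    (f := fun p : E × ℝ => fderiv ℝ β (p.1 + p.2 • u)) (by fun_prop)
  refine intervalIntegral.hasFDerivAt_integral_of_dominated_of_fderiv_le (bound := fun _ => C)
    (F' := fun x s => fderiv ℝ β (x + s • u)) (Metric.closedBall_mem_nhds y one_pos)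
    (.of_forall fun x => ?_) (Continuous.intervalIntegrable (by fun_prop) _ _) ?_
    (.of_forall fun s hs x hx => hC (x, s) ⟨hx, ?_⟩)
    (Continuous.intervalIntegrable continuous_const _ _) (.of_forall fun s _ x _ => ?_)
  · exact Continuous.aestronglyMeasurable (by fun_prop)
  · exact Continuous.aestronglyMeasurable (by fun_prop)
  · rw [Set.uIoc_of_le zero_le_one] at hs
    exact ⟨hs.1.le, hs.2⟩
  · exact ((hβ.differentiable one_ne_zero (x + s • u)).hasFDerivAt).comp x
      ((hasFDerivAt_id x).add_const (s • u))

theorem fderiv_segmentAverage [ProperSpace E] {u : E} {β : E → F} (hβ : ContDiff ℝ 1 β) :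
    fderiv ℝ (segmentAverage u β) = segmentAverage u (fderiv ℝ β) :=
  funext fun y => (hasFDerivAt_segmentAverage hβ y).fderiv

theorem contDiff_segmentAverage [ProperSpace E] {u : E} {β : E → F} (hβ : ContDiff ℝ 1 β) :
    ContDiff ℝ 1 (segmentAverage u β) := by
  rw [contDiff_one_iff_fderiv, fderiv_segmentAverage hβ]
  exact ⟨fun y => (hasFDerivAt_segmentAverage hβ y).differentiableAt,
    continuous_segmentAverage (hβ.continuous_fderiv one_ne_zero)⟩

theorem map_segmentAverage [CompleteSpace F] [CompleteSpace G] (L : F →L[ℝ] G) {u : E} {β : E → F}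
    (hβ : Continuous β) (y : E) :
    L (segmentAverage u β y) = ∫ s in (0 : ℝ)..1, L (β (y + s • u)) :=
  (L.intervalIntegral_comp_comm (Continuous.intervalIntegrable (by fun_prop) _ _)).symm

/-- The integral of a periodic function over a period does not depend on the starting point.
Invariance under one lattice vector thus becomes invariance along its whole line. -/
theorem segmentAverage_add_smul {u : E} {β : E → F} (hβ : ∀ y, β (y + u) = β y) (y : E) (t : ℝ) :
    segmentAverage u β (y + t • u) = segmentAverage u β y := by
  have hp : Function.Periodic (fun s : ℝ => β (y + s • u)) 1 := fun s => by
    change β (y + (s + 1) • u) = β (y + s • u)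
    rw [add_smul, one_smul, ← add_assoc, hβ]
  have h := hp.intervalIntegral_add_eq t 0
  rw [zero_add] at h
  rw [segmentAverage, segmentAverage, ← h]
  have h2 := intervalIntegral.integral_comp_add_left (a := (0 : ℝ)) (b := 1)
    (fun s : ℝ => β (y + s • u)) t
  rw [add_zero] at h2
  rw [← h2]
  simp only [add_smul, add_assoc]

theorem segmentAverage_add {u w : E} {β : E → F} (hβ : ∀ y, β (y + w) = β y) (y : E) :
    segmentAverage u β (y + w) = segmentAverage u β y := by
  simp only [segmentAverage, add_right_comm y w, hβ]

theorem extDeriv_segmentAverage [ProperSpace E] [CompleteSpace F] {r : ℕ} {u : E}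
    {β : E → E [⋀^Fin r]→L[ℝ] F} (hβ : ContDiff ℝ 1 β) (h0 : ∀ y, extDeriv β y = 0) (y : E) :
    extDeriv (segmentAverage u β) y = 0 := by
  rw [extDeriv, fderiv_segmentAverage hβ,
    ← ContinuousAlternatingMap.alternatizeUncurryFinCLM_apply,
    map_segmentAverage _ (hβ.continuous_fderiv one_ne_zero)]
  simp only [ContinuousAlternatingMap.alternatizeUncurryFinCLM_apply]
  refine (intervalIntegral.integral_congr (g := fun _ => 0) fun s _ => h0 _).trans ?_
  exact intervalIntegral.integral_zero

end Average

/-! ### Lattice-invariant forms on the group -/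

section Lift

variable {N : ℕ}

theorem nilMul_right_cancel {g h k : Fin (N + 2) → ℂ} (e : nilMul g k = nilMul h k) : g = h :=
  mul_right_cancel (G := NilGroup N) (b := k) e

theorem leftLin_injective (g : Fin (N + 2) → ℂ) : Function.Injective (leftLin g) :=
  have h v : leftLin (nilInv g) (leftLin g v) = v := by
    rw [← ContinuousLinearMap.comp_apply, ← leftLin_nilMul, nilInv_nilMul, leftLin_zero,
      ContinuousLinearMap.id_apply]
  Function.LeftInverse.injective h

theorem exists_pullback_nilProj {r : ℕ} (F : DiffForm (Fin (N + 2) → ℂ) (Nilmanifold N) r)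
    (y : Fin (N + 2) → ℂ) : ∃ γ, IsGaussian γ ∧ nilRep (nilProj y) = nilMul γ y ∧
      pullback nilProj F y =
        (F (nilProj y)).compContinuousLinearMap ((leftLin γ).restrictScalars ℝ) := by
  obtain ⟨γ, hγ, h1, h2⟩ := exists_mfderiv_nilProj y
  refine ⟨γ, hγ, h1, ?_⟩
  rw [pullback, h2]
  rfl

/-- The points `y` and `γ y` have the same representative, reached by lattice points `γ₁` and `γ₂`.
Cancelling `y` gives `γ₁ = γ₂ γ`, and the differentials compose accordingly. -/
theorem isLeftInvariantBy_pullback_nilProj {r : ℕ} (F : DiffForm (Fin (N + 2) → ℂ)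
    (Nilmanifold N) r) {γ : Fin (N + 2) → ℂ} (hγ : IsGaussian γ) :
    IsLeftInvariantBy γ (pullback nilProj F) := by
  intro y
  obtain ⟨γ₁, -, h1, h2⟩ := exists_pullback_nilProj F y
  obtain ⟨γ₂, -, h3, h4⟩ := exists_pullback_nilProj F (nilMul γ y)
  rw [nilProj_nilMul hγ] at h3 h4
  rw [h1, ← nilMul_assoc] at h3
  rw [h4, h2, nilMul_right_cancel h3, leftLin_nilMul]
  ext v
  rfl

theorem inChart_eq_pullback_nilProj {r : ℕ} (F : DiffForm (Fin (N + 2) → ℂ) (Nilmanifold N) r)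
    (x : Nilmanifold N) : inChart x F = pullback nilProj F := by
  rw [inChart, coe_chartAt_symm]

theorem IsLeftInvariantBy.eq_comp {r : ℕ} {γ : Fin (N + 2) → ℂ}
    {α : DiffForm (Fin (N + 2) → ℂ) (Fin (N + 2) → ℂ) r} (h : IsLeftInvariantBy γ α) :
    α = fun y => (α (nilMul γ y)).compContinuousLinearMap ((leftLin γ).restrictScalars ℝ) :=
  funext fun y => (h y).symm

theorem IsLeftInvariantBy.contDiffAt {r : ℕ} {γ : Fin (N + 2) → ℂ}
    {α : DiffForm (Fin (N + 2) → ℂ) (Fin (N + 2) → ℂ) r} (h : IsLeftInvariantBy γ α) {m : ℕ∞}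
    {y : Fin (N + 2) → ℂ} (hα : ContDiffAt ℝ m α (nilMul γ y)) : ContDiffAt ℝ m α y := by
  rw [h.eq_comp]
  have h1 : ContDiffAt ℝ m (nilMul γ) y :=
    (((contDiff_nilMul_left γ).restrict_scalars ℝ).of_le le_top).contDiffAt
  exact (ContinuousAlternatingMap.compContinuousLinearMapCLM
    ((leftLin γ).restrictScalars ℝ)).contDiff.contDiffAt.comp y (hα.comp y h1)

theorem IsLeftInvariantBy.extDeriv_eq_zero {r : ℕ} {γ : Fin (N + 2) → ℂ}
    {α : DiffForm (Fin (N + 2) → ℂ) (Fin (N + 2) → ℂ) r} (h : IsLeftInvariantBy γ α)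
    {y : Fin (N + 2) → ℂ} (hα : DifferentiableAt ℝ α (nilMul γ y))
    (h0 : extDeriv α (nilMul γ y) = 0) : extDeriv α y = 0 := by
  have h1 : ContDiffAt ℝ ∞ (nilMul γ) y :=
    (((contDiff_nilMul_left γ).restrict_scalars ℝ).of_le le_top).contDiffAt
  have h2 : ∀ z, fderiv ℝ (nilMul γ) z = (leftLin γ).restrictScalars ℝ := fun z =>
    ((hasFDerivAt_nilMul γ z).restrictScalars ℝ).fderiv
  have h3 := extDeriv_pullback hα h1 (by
    rw [minSmoothness_of_isRCLikeNormedField]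
    exact WithTop.coe_le_coe.2 (le_top : (2 : ℕ∞) ≤ ⊤))
  simp only [h2, ← h.eq_comp, h0] at h3
  rw [h3]
  rfl

/-- A Kähler metric on the nilmanifold lifts to a closed positive lattice-invariant form. -/
theorem exists_lift_of_isKahlerManifold
    (h : IsKahlerManifold (Fin (N + 2) → ℂ) (Nilmanifold N)) :
    ∃ α : DiffForm (Fin (N + 2) → ℂ) (Fin (N + 2) → ℂ) 2, ContDiff ℝ 1 α ∧
      (∀ y, extDeriv α y = 0) ∧ (∀ γ, IsGaussian γ → IsLeftInvariantBy γ α) ∧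
      ∀ y v, v ≠ 0 → 0 < (α y ![v, Complex.I • v]).re := by
  obtain ⟨F, hF, hd⟩ := h
  have hinv := fun γ (hγ : IsGaussian γ) => isLeftInvariantBy_pullback_nilProj F hγ
  -- The charts control the lifted form near the chosen representatives only; lattice invariance
  -- carries smoothness and closedness to the other points.
  have hs : ∀ x : Nilmanifold N, ContDiffAt ℝ 1 (pullback nilProj F) (nilRep x) := fun x => by
    have h1 := hF.smooth x
    rw [inChart_eq_pullback_nilProj] at h1
    refine (h1.contDiffAt ((chartAt _ x).open_target.mem_nhds ?_)).of_le (by simp)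
    rw [← chartAt_self]
    exact mem_chart_target _ x
  refine ⟨pullback nilProj F, contDiff_iff_contDiffAt.2 fun y => ?_, fun y => ?_, hinv,
    fun y v hv => ?_⟩
  · obtain ⟨γ, hγ, h1, -⟩ := exists_mfderiv_nilProj y
    exact (hinv γ hγ).contDiffAt (m := 1) (h1 ▸ hs _)
  · obtain ⟨γ, hγ, h1, -⟩ := exists_mfderiv_nilProj y
    refine (hinv γ hγ).extDeriv_eq_zero (h1 ▸ (hs _).differentiableAt one_ne_zero) ?_
    have h2 := congrFun hd (nilProj y)
    rw [extd, inChart_eq_pullback_nilProj, chartAt_self, h1] at h2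
    exact h2
  · obtain ⟨γ, -, -, h2⟩ := exists_pullback_nilProj F y
    have h3 := hF.pos (nilProj y) (leftLin γ v)
      fun e => hv (leftLin_injective γ (e.trans (map_zero _).symm))
    rw [h2]
    change 0 < (F (nilProj y) fun i => leftLin γ (![v, Complex.I • v] i)).re
    convert h3 using 3
    funext i
    fin_cases i
    · rfl
    · exact map_smul (leftLin γ) Complex.I v

end Lift

/-! ### The nilmanifold is not Kähler -/

section NotKahler

variable {N : ℕ}

theorem nilMul_add_smul_lastVec (g y : Fin (N + 2) → ℂ) (s : ℝ) (c : ℂ) :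
    nilMul g (y + s • c • lastVec N) = nilMul g y + s • c • lastVec N := by
  have h : leftLin g (s • c • lastVec N) = s • c • lastVec N := by
    rw [← Complex.coe_smul, smul_smul, map_smul, leftLin_apply, cocycle_lastVec, zero_smul,
      add_zero]
  rw [nilMul, nilMul, map_add, h, add_assoc]

theorem nilMul_smul_lastVec (c : ℂ) (y : Fin (N + 2) → ℂ) :
    nilMul (c • lastVec N) y = y + c • lastVec N := by
  simp [nilMul, leftLin_apply, cocycle_smul_lastVec, add_comm]

theorem isGaussian_smul_single {c : ℂ} (hc : c ∈ GaussianInt.toComplex.range)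
    (i : Fin (N + 2)) : IsGaussian (c • Pi.single i (1 : ℂ)) := by
  intro j
  by_cases h : j = i
  · subst h; simpa using hc
  · simp [h, zero_mem]

variable {α : DiffForm (Fin (N + 2) → ℂ) (Fin (N + 2) → ℂ) 2}

theorem IsLeftInvariantBy.apply {r : ℕ} {γ : Fin (N + 2) → ℂ}
    {α : DiffForm (Fin (N + 2) → ℂ) (Fin (N + 2) → ℂ) r} (h : IsLeftInvariantBy γ α)
    (y : Fin (N + 2) → ℂ) (w : Fin r → Fin (N + 2) → ℂ) :
    α (nilMul γ y) (fun i => leftLin γ (w i)) = α y w :=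
  DFunLike.congr_fun (h y) w

theorem IsLeftInvariantBy.eq_add_smul_lastVec {c : ℂ} (h : IsLeftInvariantBy (c • lastVec N) α)
    (y : Fin (N + 2) → ℂ) : α (y + c • lastVec N) = α y := by
  ext w
  rw [← h.apply y w, nilMul_smul_lastVec]
  simp [leftLin_apply, cocycle_smul_lastVec]

/-- Translations along the last axis are central, so averaging over them commutes with the pullback
by `γ`. -/
theorem IsLeftInvariantBy.segmentAverage {γ : Fin (N + 2) → ℂ} (h : IsLeftInvariantBy γ α)
    (hα : Continuous α) (c : ℂ) : IsLeftInvariantBy γ (segmentAverage (c • lastVec N) α) := by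
  intro y
  refine (map_segmentAverage (ContinuousAlternatingMap.compContinuousLinearMapCLM
    ((leftLin γ).restrictScalars ℝ)) hα (nilMul γ y)).trans ?_
  refine intervalIntegral.integral_congr fun s _ => ?_
  simp only [← nilMul_add_smul_lastVec]
  exact h _

theorem re_segmentAverage_pos {α : (Fin (N + 2) → ℂ) → (Fin (N + 2) → ℂ) [⋀^Fin 2]→L[ℝ] ℂ}
    (hα : Continuous α) (u : Fin (N + 2) → ℂ)
    {w : Fin 2 → Fin (N + 2) → ℂ} (hw : ∀ y, 0 < (α y w).re) (y : Fin (N + 2) → ℂ) :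
    0 < (segmentAverage u α y w).re := by
  have h := map_segmentAverage (Complex.reCLM.comp (ContinuousAlternatingMap.apply ℝ _ ℂ w))
    (u := u) hα y
  refine lt_of_lt_of_eq ?_ h.symm
  exact intervalIntegral.intervalIntegral_pos_of_pos
    (Continuous.intervalIntegrable (by fun_prop) _ _) (fun s => hw _) one_pos

theorem map_vecCons_swap {E : Type*} [NormedAddCommGroup E] [NormedSpace ℂ E]
    (a : E [⋀^Fin 2]→L[ℝ] ℂ) (v w : E) : a ![v, w] = -a ![w, v] := by
  have h := a.toAlternatingMap.map_swap ![w, v] (i := 0) (j := 1) (by decide)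
  refine Eq.trans (congrArg a ?_) h
  funext i
  fin_cases i <;> rfl

theorem fderiv_apply_eq_zero_of_invariant {E F : Type*} [NormedAddCommGroup E] [NormedSpace ℝ E]
    [NormedAddCommGroup F] [NormedSpace ℝ F] {β : E → F} {u : E} (hβ : Differentiable ℝ β)
    (h : ∀ y (t : ℝ), β (y + t • u) = β y) (y : E) : fderiv ℝ β y u = 0 := by
  have h1 : HasDerivAt (fun t : ℝ => β (y + t • u)) (fderiv ℝ β y u) 0 :=
    (hβ y).hasFDerivAt.hasLineDerivAt u
  simp only [h] at h1
  exact h1.unique (hasDerivAt_const _ _)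

/-- A closed lattice-invariant form, invariant under the centre, is not positive there. -/
theorem not_pos_of_closed (hN : N ≠ 0) (hα : ContDiff ℝ 1 α) (h0 : ∀ y, extDeriv α y = 0)
    (hinv : ∀ γ, IsGaussian γ → IsLeftInvariantBy γ α)
    (h1 : ∀ y (t : ℝ), α (y + t • (1 : ℂ) • lastVec N) = α y)
    (h2 : ∀ y (t : ℝ), α (y + t • Complex.I • lastVec N) = α y) :
    ¬ ∀ y, 0 < (α y ![lastVec N, Complex.I • lastVec N]).re := by
  intro hpos
  set e : Fin (N + 2) → ℂ := lastVec N with he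
  set u : Fin (N + 2) → ℂ := Pi.single 0 1 with hu
  have hcoc : ∀ (c : ℂ) v, cocycle (c • u) v = starRingEnd ℂ c * v 0 := fun c v => by
    rw [cocycle_apply, Finset.sum_eq_single 0]
    · have : coef N 0 = 1 := by simp [coef, coefInt, Nat.pos_of_ne_zero hN]
      simp [hu, this]
    · intro j _ hj
      simp [hu, hj]
    · simp
  -- Translation by the lattice point `c u` shears a tangent vector along `e` and fixes `e`.
  have htrans : ∀ (c : ℂ), c ∈ GaussianInt.toComplex.range → ∀ y v,
      α (nilMul (c • u) y) ![v + (starRingEnd ℂ c * v 0) • e, e] = α y ![v, e] := by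
    intro c hc y v
    rw [← (hinv _ (isGaussian_smul_single hc 0)).apply y]
    congr 1
    funext i
    fin_cases i
    · change _ = leftLin (c • u) v
      rw [leftLin_apply, hcoc]
      rfl
    · change _ = leftLin (c • u) e
      rw [leftLin_apply, he, cocycle_lastVec, zero_smul, add_zero]
      rfl
  have hu0 : u 0 = 1 := by simp [hu]
  -- The unit square in the complex line of the first coordinate. Opposite sides correspond under
  -- translation by `u` and by `i u`, up to a central shift along `i e`.
  set P : ℝ × ℝ → Fin (N + 2) → ℂ := fun p => p.1 • u + p.2 • Complex.I • u with hP
  have hPd : ∀ p, HasFDerivAt P ((ContinuousLinearMap.fst ℝ ℝ ℝ).smulRight u +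
      (ContinuousLinearMap.snd ℝ ℝ ℝ).smulRight (Complex.I • u)) p := fun p =>
    ((ContinuousLinearMap.fst ℝ ℝ ℝ).smulRight u +
      (ContinuousLinearMap.snd ℝ ℝ ℝ).smulRight (Complex.I • u)).hasFDerivAt
  -- Translation by `u` turns `i u` into `i u + i e`, and the extra term contributes `α(e, i e)`.
  -- The central displacement `y i e` of the point is removed by `h2`.
  have hx : ∀ y, (α (P (1, y)) ![Complex.I • u, e]).re - (α (P (0, y)) ![Complex.I • u, e]).re =
      (α (P (1, y)) ![e, Complex.I • e]).re := by
    intro y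
    have h := htrans 1 (one_mem _) (P (0, y)) (Complex.I • u)
    have h3 : nilMul ((1 : ℂ) • u) (P (0, y)) = P (1, y) + y • Complex.I • e := by
      rw [nilMul, leftLin_apply, hcoc, ← he]
      ext j
      simp [hP, hu0]
      ring
    rw [h3, h2, ContinuousAlternatingMap.vecCons_add] at h
    rw [← h, map_vecCons_swap _ _ (Complex.I • e)]
    simp [hu0]
  -- Translation by `i u` turns `u` into `u - i e`, so this pair of sides contributes with the same
  -- sign as the other.
  have hy : ∀ x, -(α (P (x, 1)) ![u, e]).re - -(α (P (x, 0)) ![u, e]).re =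
      (α (P (x, 1)) ![e, Complex.I • e]).re := by
    intro x
    have h := htrans Complex.I ⟨⟨0, 1⟩, by simp [GaussianInt.toComplex_def]⟩ (P (x, 0)) u
    have h3 : nilMul (Complex.I • u) (P (x, 0)) = P (x, 1) + (-x) • Complex.I • e := by
      rw [nilMul, leftLin_apply, hcoc, ← he]
      ext j
      simp [hP, hu0]
      ring
    have h4 : (starRingEnd ℂ Complex.I * u 0) • e = (-1 : ℝ) • Complex.I • e := by
      simp [hu0]
    rw [h3, h2, h4, ContinuousAlternatingMap.vecCons_add, ContinuousAlternatingMap.vecCons_smul,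
      map_vecCons_swap _ (Complex.I • e)] at h
    rw [← h]
    simp
  have hf : ∀ (w : Fin 2 → Fin (N + 2) → ℂ) p, HasFDerivAt (fun p => (α (P p) w).re)
      ((Complex.reCLM.comp (ContinuousAlternatingMap.apply ℝ _ ℂ w)).comp
        ((fderiv ℝ α (P p)).comp ((ContinuousLinearMap.fst ℝ ℝ ℝ).smulRight u +
          (ContinuousLinearMap.snd ℝ ℝ ℝ).smulRight (Complex.I • u)))) p := fun w p =>
    (Complex.reCLM.comp (ContinuousAlternatingMap.apply ℝ _ ℂ w)).hasFDerivAt.comp p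
      (((hα.differentiable one_ne_zero (P p)).hasFDerivAt).comp p (hPd p))
  have hfc : ∀ w : Fin 2 → Fin (N + 2) → ℂ, Continuous fun p => (α (P p) w).re := fun w =>
    continuous_iff_continuousAt.2 fun p => (hf w p).continuousAt
  -- This is `dα(u, i u, e) = 0`; the term differentiating along `e` vanishes by invariance.
  have hdiv : ∀ p : ℝ × ℝ, (fderiv ℝ α (P p) u ![Complex.I • u, e]).re -
      (fderiv ℝ α (P p) (Complex.I • u) ![u, e]).re = 0 := by
    intro p
    have h := DFunLike.congr_fun (h0 (P p)) ![u, Complex.I • u, e]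
    rw [extDeriv, ContinuousAlternatingMap.alternatizeUncurryFin_apply, Fin.sum_univ_three] at h
    have h5 : fderiv ℝ α (P p) e = 0 := by
      simpa using fderiv_apply_eq_zero_of_invariant (hα.differentiable one_ne_zero) h1 (P p)
    have r0 : (0 : Fin 3).removeNth ![u, Complex.I • u, e] = ![Complex.I • u, e] := by
      funext i; fin_cases i <;> rfl
    have r1 : (1 : Fin 3).removeNth ![u, Complex.I • u, e] = ![u, e] := by
      funext i; fin_cases i <;> rfl
    have s2 : ![u, Complex.I • u, e] 2 = e := rfl
    rw [r0, r1, s2, h5] at h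
    have h6 := congrArg Complex.re h
    simpa [sub_eq_add_neg] using h6
  -- Green's theorem for `α(·, e)` on the square: the interior integral is zero, whereas the
  -- boundary integral is a sum of two positive ones.
  have key := MeasureTheory.integral2_divergence_prod_of_hasFDerivAt
    (fun p => (α (P p) ![Complex.I • u, e]).re) (fun p => -(α (P p) ![u, e]).re) _ _ 0 0 1 1
    (hfc _).continuousOn (hfc _).neg.continuousOn (fun p _ => hf _ p) (fun p _ => (hf _ p).neg)
    (by
      refine (MeasureTheory.integrableOn_zero).congr_fun (fun p _ => ?_) (by measurability)
      simpa [sub_eq_add_neg] using (hdiv p).symm)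
  refine absurd (key.symm.trans (c := 0) ?_) (ne_of_gt ?_)
  · refine (intervalIntegral.integral_congr (g := fun _ => 0) fun x _ =>
      (intervalIntegral.integral_congr (g := fun _ => (0 : ℝ)) fun y _ => ?_).trans
        intervalIntegral.integral_zero).trans intervalIntegral.integral_zero
    simpa [sub_eq_add_neg] using hdiv (x, y)
  · have ix : ∀ (w : Fin 2 → Fin (N + 2) → ℂ) (s : ℝ), IntervalIntegrable
        (fun x => (α (P (x, s)) w).re) MeasureTheory.volume 0 1 := fun w s =>
      ((hfc w).comp (continuous_id.prodMk continuous_const)).intervalIntegrable _ _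
    have jx : ∀ (w : Fin 2 → Fin (N + 2) → ℂ) (s : ℝ), IntervalIntegrable
        (fun x => -(α (P (x, s)) w).re) MeasureTheory.volume 0 1 := fun w s => (ix w s).neg
    have iy : ∀ (w : Fin 2 → Fin (N + 2) → ℂ) (s : ℝ), IntervalIntegrable
        (fun y => (α (P (s, y)) w).re) MeasureTheory.volume 0 1 := fun w s =>
      ((hfc w).comp (continuous_const.prodMk continuous_id)).intervalIntegrable _ _
    rw [← intervalIntegral.integral_sub (jx _ 1) (jx _ 0), add_sub_assoc,
      ← intervalIntegral.integral_sub (iy _ 1) (iy _ 0)]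
    simp only [hx, hy]
    exact add_pos
      (intervalIntegral.intervalIntegral_pos_of_pos (ix _ 1) (fun x => hpos _) one_pos)
      (intervalIntegral.intervalIntegral_pos_of_pos (iy _ 1) (fun x => hpos _) one_pos)

theorem not_isKahlerManifold (hN : N ≠ 0) :
    ¬ IsKahlerManifold (Fin (N + 2) → ℂ) (Nilmanifold N) := by
  intro h
  obtain ⟨α, hα, h0, hinv, hpos⟩ := exists_lift_of_isKahlerManifold h
  have g1 : IsGaussian ((1 : ℂ) • lastVec N) := isGaussian_smul_single (one_mem _) _
  have g2 : IsGaussian (Complex.I • lastVec N) :=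
    isGaussian_smul_single ⟨⟨0, 1⟩, by simp [GaussianInt.toComplex_def]⟩ _
  have hα1 := contDiff_segmentAverage (u := (1 : ℂ) • lastVec N) hα
  have hne : lastVec N ≠ 0 := fun e => one_ne_zero (lastVec_last.symm.trans (congrFun e _))
  -- The first average gives invariance along `e`, and the second, along `i e`, preserves it.
  -- Closedness, lattice invariance and positivity on the fibre survive both.
  refine not_pos_of_closed hN (contDiff_segmentAverage (u := Complex.I • lastVec N) hα1)
    (extDeriv_segmentAverage hα1 (extDeriv_segmentAverage hα h0))
    (fun γ hγ => ((hinv γ hγ).segmentAverage hα.continuous 1).segmentAverage hα1.continuous _)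
    (fun y t => segmentAverage_add (fun y => segmentAverage_add_smul
      (hinv _ g1).eq_add_smul_lastVec y t) y)
    (fun y t => segmentAverage_add_smul (segmentAverage_add (hinv _ g2).eq_add_smul_lastVec) y t)
    (re_segmentAverage_pos hα1.continuous _ (re_segmentAverage_pos hα.continuous _
      fun y => hpos y _ hne))

end NotKahler

end CplxGeom

end

theorem theorem2p4 (n : ℕ) (hn : 4 ≤ n) :
    ∃ (X : Type) (_ : TopologicalSpace X) (_ : ChartedSpace (Fin n → ℂ) X),
      IsCompactComplexManifold (Fin n → ℂ) X ∧
      ¬ IsKahlerManifold (Fin n → ℂ) X ∧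
      (∃ F' : DiffForm (Fin n → ℂ) X 2, IsBalanced n F') ∧
      (∃ F : DiffForm (Fin n → ℂ) X 2, IsAsthenoKahler n F ∧
        ∀ k : ℕ, 1 ≤ k → k ≤ n - 1 → IsGauduchon n k F) ∧
      -- the description of `X` as a complex nilmanifold with its structure equations
      ∃ (G : Type) (_ : Group G) (_ : TopologicalSpace G) (_ : ChartedSpace (Fin n → ℂ) G)
        (Γ : Subgroup G) (π : G → X) (θ : Fin n → DiffForm (Fin n → ℂ) X 1) (a : Fin n → ℝ),
        IsComplexNilmanifold (Fin n → ℂ) Γ π ∧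
        Nonempty (G ≃ₜ* HeisenbergGroup (n - 1) × Multiplicative ℝ) ∧
        IsInvariantCoframe π θ ∧
        StructureEquations θ a ∧
        (∀ j : Fin n, (j : ℕ) + 1 < n → a j ≠ 0) ∧
        ∑ j ∈ Finset.univ.filter (fun j : Fin n => (j : ℕ) + 1 < n), a j = 0 := by
  -- Of the `n = N + 2` coordinates, `N` carry the coefficient `1`, one carries `-N`, and the last
  -- is the fibre. The bound `N ≥ 2` keeps the astheno-Kähler parameter `2N/(N-1)` finite and
  -- positive.
  obtain ⟨N, rfl⟩ := Nat.exists_eq_add_of_le' (show 2 ≤ n by omega)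
  have h2 : 2 ≤ N := by omega
  have h0 : N ≠ 0 := by omega
  exact ⟨Nilmanifold N, inferInstance, inferInstance, isCompactComplexManifold_nilmanifold,
    not_isKahlerManifold h0, ⟨_, isBalanced_metricForm h0⟩,
    ⟨_, isAsthenoKahler_metricForm h2, fun k hk hk' => isGauduchon_metricForm h2 hk hk'⟩,
    NilGroup N, inferInstance, inferInstance, inferInstance, gaussianLattice N, nilProj,
    nilCoframe, coef N, isComplexNilmanifold_nilProj, ⟨NilGroup.heisenbergEquiv h0⟩,
    isInvariantCoframe_nilCoframe, structureEquations_nilCoframe,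
    fun j hj => coef_ne_zero h0 hj, sum_coef N⟩
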